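/- Let $\mathbb T=\mathbb R/\mathbb Z$ and let $f:\mathbb T\to(0,\infty)$ be a real analytic function that is not a trigonometric polynomial, with $\int_{\mathbb T} f=1$ and Fourier coefficients $a_k=\int_{\mathbb T} f(x)e^{-2\pi i kx}\,dx$. For $n\ge 1$ put $T_n=\sum_{j\ge 2}|a_{jn}|\,|jn|$, and let $1\le l_1<l_2<\cdots$ be integers with $a_{l_k}\neq 0$ for all $k$ and $|a_{l_k}|/T_{l_k}\to\infty$ (that is, $T_{l_k}/|a_{l_k}|\to0$). For an irrational number $\alpha$ let $q_0(\alpha)=1,\ q_1(\alpha),\ q_2(\alpha),\dots$ be the denominators of the convergents of its continued fraction. Let $\beta$ be irrational and write $q_n'=q_n(\beta)$. For $k\ge 1$ let $\eta(k)$ be the smallest $n\ge1$ with $q_n'>2k^2/|a_{l_k}|^2$. For $n,j\ge 1$ define $$V_{n,j}=\{\alpha\in\mathbb R\setminus\mathbb Q:\ q_n(\alpha)=l_j,\ q_{n+1}(\alpha)>2q'_{\eta(j)}n^2\},\qquad \mathcal U_j=\bigcup_{n\ge1}V_{n,j},\qquad \mathcal U=\bigcap_{M\ge1}\bigcup_{j\ge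 M}\mathcal U_j .$$ Let $T^f_\alpha=(T_t)_{t\in\mathbb R}$ be the special flow over the rotation $x\mapsto x+\alpha$ of $\mathbb T$ under the roof $f$: it acts on $\{(x,r):0\le r<f(x)\}$, with Lebesgue measure, by $T_t(x,r)=(x+n\alpha,\ r+t-S_n(f)(x))$, where $S_n(f)$, $n\in\mathbb Z$, are the Birkhoff sums of $f$ over the rotation (the additive cocycle with $S_0(f)=0$ and $S_{n+1}(f)(x)=S_n(f)(x)+f(x+n\alpha)$) and $n$ is the unique integer with $S_n(f)(x)\le r+t<S_{n+1}(f)(x)$. A measure-preserving flow $(T_t)$ on a probability space $(X,\mu)$ is mixing along a real sequence $t_n\to\infty$ if $\langle g_1\circ T_{t_n},g_2\rangle\to\langle g_1,1\rangle\langle 1,g_2\rangle$ for all $g_1,g_2\in L^2(X,\mu)$. **Theorem.** For every $\alpha\in\mathcal U$ the flow $T_\alpha^f$ is mixing along a subsequence of $(q'_{\eta(j)})_{j\ge1}$, namely along the indices $j$ with $\alpha\in\mathcal U_j$: there are strictly increasing sequences $1\le k_1<k_2<\cdots$ with $\alpha\in\mathcal U_{k_n}$ for all $n$, and for every such sequence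 $T_\alpha^f$ is mixing along $(q'_{\eta(k_n)})_{n\ge1}$. -/

import Mathlib

open MeasureTheory Filter Topology

noncomputable section

namespace SpecialFlowMixing

/-! ### Special flows over circle rotations -/

/-- The Birkhoff cocycle `S_n(f)(x)`, `n ∈ ℤ`, over the rotation `x ↦ x + α` of `ℝ/ℤ`:
`∑_{0 ≤ i < n} f (x + i α)` for `n ≥ 0` and `-∑_{n ≤ i < 0} f (x + i α)` for `n < 0`
(one of the two sums below is always empty). -/
def birkhoff (α : ℝ) (f : UnitAddCircle → ℝ) (n : ℤ) (x : UnitAddCircle) : ℝ :=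
  ∑ i ∈ Finset.Ico (0 : ℤ) n, f (x + i • (α : UnitAddCircle))
    - ∑ i ∈ Finset.Ico n (0 : ℤ), f (x + i • (α : UnitAddCircle))

/-- The region `{(x, r) : 0 ≤ r < f x}` below the roof function. -/
def flowSpace (f : UnitAddCircle → ℝ) : Set (UnitAddCircle × ℝ) :=
  {p | 0 ≤ p.2 ∧ p.2 < f p.1}

/-- Lebesgue measure on the region below the roof (of total mass `∫ f`). -/
def flowMeasure (f : UnitAddCircle → ℝ) : Measure (UnitAddCircle × ℝ) :=
  (volume : Measure (UnitAddCircle × ℝ)).restrict (flowSpace f)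

/-- The integer `n` with `S_n(f)(x) ≤ s < S_{n+1}(f)(x)`; it exists and is unique
for continuous `f > 0`, see `existsUnique_crossings`. -/
def crossings (α : ℝ) (f : UnitAddCircle → ℝ) (x : UnitAddCircle) (s : ℝ) : ℤ :=
  Classical.epsilon fun n : ℤ => birkhoff α f n x ≤ s ∧ s < birkhoff α f (n + 1) x

/-- The time-`t` map of the special flow over the rotation by `α` under the roof `f`:
`T_t (x, r) = (x + n α, r + t - S_n(f)(x))` with `S_n(f)(x) ≤ r + t < S_{n+1}(f)(x)`.
Only its values on `flowSpace f` matter, as `flowMeasure f` is carried by that set. -/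
def specialFlow (α : ℝ) (f : UnitAddCircle → ℝ) (t : ℝ) (p : UnitAddCircle × ℝ) :
    UnitAddCircle × ℝ :=
  (p.1 + crossings α f p.1 (p.2 + t) • (α : UnitAddCircle),
    p.2 + t - birkhoff α f (crossings α f p.1 (p.2 + t)) p.1)

theorem birkhoff_zero (α : ℝ) (f : UnitAddCircle → ℝ) (x : UnitAddCircle) :
    birkhoff α f 0 x = 0 := by
  simp [birkhoff]

theorem birkhoff_add_one (α : ℝ) (f : UnitAddCircle → ℝ) (n : ℤ) (x : UnitAddCircle) :
    birkhoff α f (n + 1) x = birkhoff α f n x + f (x + n • (α : UnitAddCircle)) := by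
  unfold birkhoff
  rcases le_or_gt 0 n with h | h
  · have h1 : Finset.Ico (0 : ℤ) (n + 1) = insert n (Finset.Ico 0 n) := by
      ext i; simp; omega
    have h2 : Finset.Ico n (0 : ℤ) = ∅ := by ext i; simp; omega
    have h3 : Finset.Ico (n + 1) (0 : ℤ) = ∅ := by ext i; simp; omega
    rw [h1, h2, h3, Finset.sum_insert (by simp)]
    simp; ring
  · have h1 : Finset.Ico n (0 : ℤ) = insert n (Finset.Ico (n + 1) 0) := by
      ext i; simp; omega
    have h2 : Finset.Ico (0 : ℤ) n = ∅ := by ext i; simp; omega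
    have h3 : Finset.Ico (0 : ℤ) (n + 1) = ∅ := by ext i; simp; omega
    rw [h1, h2, h3, Finset.sum_insert (by simp)]
    simp

theorem existsUnique_crossings (α : ℝ) {f : UnitAddCircle → ℝ} (hf : Continuous f)
    (hpos : ∀ x, 0 < f x) (x : UnitAddCircle) (s : ℝ) :
    ∃! n : ℤ, birkhoff α f n x ≤ s ∧ s < birkhoff α f (n + 1) x := by
  obtain ⟨y, -, hy⟩ := isCompact_univ.exists_isMinOn
    (Set.univ_nonempty (α := UnitAddCircle)) hf.continuousOn
  have hc : ∀ z, f y ≤ f z := fun z => hy (Set.mem_univ z)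
  have hmono : StrictMono fun n : ℤ => birkhoff α f n x :=
    strictMono_int_of_lt_succ fun n => by
      rw [birkhoff_add_one]; linarith [hpos (x + n • (α : UnitAddCircle))]
  have hup : ∀ n : ℕ, (n : ℝ) * f y ≤ birkhoff α f n x := by
    intro n
    induction n with
    | zero => simp [birkhoff_zero]
    | succ k ih =>
      push_cast
      rw [birkhoff_add_one]
      linarith [hc (x + (k : ℤ) • (α : UnitAddCircle))]
  have hdown : ∀ n : ℕ, birkhoff α f (-(n : ℤ)) x ≤ -((n : ℝ) * f y) := by
    intro n
    induction n with
    | zero => simp [birkhoff_zero]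
    | succ k ih =>
      have h := birkhoff_add_one α f (-((k + 1 : ℕ) : ℤ)) x
      have e : -((k + 1 : ℕ) : ℤ) + 1 = -(k : ℤ) := by push_cast; ring
      rw [e] at h
      push_cast at h ⊢
      linarith [hc (x + (-((k : ℤ) + 1)) • (α : UnitAddCircle))]
  obtain ⟨N, hN⟩ := exists_nat_gt (|s| / f y)
  rw [div_lt_iff₀ (hpos y)] at hN
  obtain ⟨n, hn, hmax⟩ := Int.exists_greatest_of_bdd
    (P := fun n : ℤ => birkhoff α f n x ≤ s)
    ⟨N, fun z hz => by
      by_contra hlt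
      have := hmono (not_le.mp hlt)
      simp only at this
      linarith [hup N, le_abs_self s]⟩
    ⟨-(N : ℤ), by linarith [hdown N, neg_abs_le s]⟩
  refine ⟨n, ⟨hn, ?_⟩, ?_⟩
  · by_contra h
    have := hmax (n + 1) (not_lt.mp h)
    omega
  · rintro m ⟨hm1, hm2⟩
    have h1 : m < n + 1 := by
      by_contra h
      have h' := hmax m hm1
      omega
    have h2 : n < m + 1 := hmono.lt_iff_lt.mp (lt_of_le_of_lt hn hm2)
    omega

/-! ### Mixing along a sequence -/

/-- A measure-preserving flow `T` on a probability space is mixing along a real sequence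
`a_n → ∞` if `⟨g₁ ∘ T_{a_n}, g₂⟩ → ⟨g₁, 1⟩ ⟨1, g₂⟩` for all `g₁, g₂ ∈ L²`. -/
structure IsMixingAlong {X : Type*} [MeasurableSpace X] (T : ℝ → X → X) (μ : Measure X)
    (a : ℕ → ℝ) : Prop where
  isProbabilityMeasure : IsProbabilityMeasure μ
  measurePreserving : ∀ t, MeasurePreserving (T t) μ μ
  tendsto_atTop : Tendsto a atTop atTop
  tendsto_correlation : ∀ g₁ g₂ : X → ℂ, MemLp g₁ 2 μ → MemLp g₂ 2 μ →
    Tendsto (fun n => ∫ x, g₁ (T (a n) x) * (starRingEnd ℂ) (g₂ x) ∂μ) atTop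
      (𝓝 ((∫ x, g₁ x ∂μ) * ∫ x, (starRingEnd ℂ) (g₂ x) ∂μ))

/-! ### The roof function and its Fourier coefficients -/

/-- Real analyticity of a function on the circle `ℝ/ℤ`. -/
def IsRealAnalytic (f : UnitAddCircle → ℝ) : Prop :=
  AnalyticOnNhd ℝ (fun x : ℝ => f (x : UnitAddCircle)) Set.univ

/-- `f` is a (finite) trigonometric polynomial. -/
def IsTrigPolynomial (f : UnitAddCircle → ℝ) : Prop :=
  ∃ c : ℤ →₀ ℂ, ∀ x : UnitAddCircle, (f x : ℂ) = c.sum fun k z => z * fourier k x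

/-- The Fourier coefficient `a_k = ∫ f(x) e^{-2πikx} dx`. -/
def coeff (f : UnitAddCircle → ℝ) (k : ℤ) : ℂ :=
  fourierCoeff (fun x : UnitAddCircle => (f x : ℂ)) k

/-- `T_n = ∑_{j ≥ 2} |a_{jn}| |jn|`. -/
def fourierTail (f : UnitAddCircle → ℝ) (n : ℕ) : ℝ :=
  ∑' j : ℕ, ‖coeff f (((j + 2) * n : ℕ) : ℤ)‖ * (((j + 2) * n : ℕ) : ℝ)

/-- `l_1 < l_2 < ⋯` are positive integers with `a_{l_k} ≠ 0` and `|a_{l_k} / T_{l_k}| → ∞`.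
The limit is written for the reciprocals, so that `T_{l_k} = 0` (quotient `∞`) is allowed.
The value `l 0` plays no role. -/
structure IsDominantSequence (f : UnitAddCircle → ℝ) (l : ℕ → ℕ) : Prop where
  strictMonoOn : StrictMonoOn l (Set.Ici 1)
  pos : ∀ k, 1 ≤ k → 0 < l k
  coeff_ne_zero : ∀ k, 1 ≤ k → coeff f (l k) ≠ 0
  tendsto_zero : Tendsto (fun k => fourierTail f (l k) / ‖coeff f (l k)‖) atTop (𝓝 0)

/-! ### The set of rotation numbers -/

/-- The denominator `q_n(α)` of the `n`-th convergent of the continued fraction of `α`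
(`q_0 = 1`, `q_1 = a_1`, `q_n = a_n q_{n-1} + q_{n-2}`). -/
def convDen (α : ℝ) (n : ℕ) : ℝ :=
  (GenContFract.of α).dens n

/-- `η(k)`: the smallest index `n ≥ 1` with `q_n(β) > 2 k² / |a_{l_k}|²`. -/
def eta (β : ℝ) (f : UnitAddCircle → ℝ) (l : ℕ → ℕ) (k : ℕ) : ℕ :=
  sInf {n : ℕ | 1 ≤ n ∧ 2 * (k : ℝ) ^ 2 / ‖coeff f (l k)‖ ^ 2 < convDen β n}

/-- `V_{n,m}`: irrational `α` with `q_n(α) = l_m` and `q_{n+1}(α) > 2 q_{η(m)}(β) n²`. -/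
def setV (β : ℝ) (f : UnitAddCircle → ℝ) (l : ℕ → ℕ) (n m : ℕ) : Set ℝ :=
  {α | Irrational α ∧ convDen α n = l m ∧
    2 * convDen β (eta β f l m) * (n : ℝ) ^ 2 < convDen α (n + 1)}

/-- `U_j = ⋃_{n ≥ 1} V_{n,j}`. -/
def setUj (β : ℝ) (f : UnitAddCircle → ℝ) (l : ℕ → ℕ) (j : ℕ) : Set ℝ :=
  ⋃ n ≥ 1, setV β f l n j

/-- `U = ⋂_{M ≥ 1} ⋃_{j ≥ M} U_j`. -/
def setU (β : ℝ) (f : UnitAddCircle → ℝ) (l : ℕ → ℕ) : Set ℝ :=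
  ⋂ M ≥ 1, ⋃ j ≥ M, setUj β f l j

end SpecialFlowMixing

end

/-!
At the times `t_j = q'_{η(j)}` with `α ∈ U_j`, the frequency `q = l_j` is a convergent denominator
of `α` whose successor is much larger than `t_j`. Hence for `n` up to order `t_j` the oscillation of
`S_n(f)` is that of `n (a_q e_q + a_{-q} e_{-q})`: the multiples of `q` contribute at most `n T_q`,
which is negligible against `n |a_q|`, and the other frequencies have divisors `|e_k(α) - 1|` of
order at least `1 / q`.

Consequently a horizontal displacement by `s · S / (t_j |a_q| q)`, `s ∈ [0, 1]`, changes a test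
function negligibly but moves its image under `T_{t_j}` along the orbit by about `w s`, where `|w|`
is of order `S` off a small neighbourhood of the zeros of `Im (a_q e_q)`. Averaging over `s` thus
turns a correlation of test functions into the integral of one of them against the orbit average of
the other over a time of order `S`, and orbit averages converge uniformly, by Weyl equidistribution
for the irrational rotation. Finally, test functions are dense in `L²`.
-/

noncomputable section

namespace SpecialFlowMixing

/-! ### Convergents of continued fractions -/

theorem not_terminatedAt_of_irrational {α : ℝ} (hα : Irrational α) (n : ℕ) :
    ¬ (GenContFract.of α).TerminatedAt n := fun h =>
  have ⟨q, hq⟩ := GenContFract.exists_rat_eq_of_terminates ⟨n, h⟩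
  hα ⟨q, hq.symm⟩

theorem convDen_monotone (α : ℝ) : Monotone (convDen α) :=
  monotone_nat_of_le_succ fun _ => GenContFract.of_den_mono

theorem tendsto_convDen {α : ℝ} (hα : Irrational α) : Tendsto (convDen α) atTop atTop := by
  refine tendsto_atTop_mono' atTop ?_ (tendsto_natCast_atTop_atTop (R := ℝ))
  filter_upwards [eventually_ge_atTop 5] with n hn
  have hfib : (Nat.fib (n + 1) : ℝ) ≤ convDen α n :=
    GenContFract.succ_nth_fib_le_of_nth_den (Or.inr (not_terminatedAt_of_irrational hα (n - 1)))
  exact (Nat.cast_le.mpr ((Nat.le_fib_self hn).trans Nat.fib_le_fib_succ)).trans hfib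

theorem exists_int_eq_contsAux {K : Type*} [Field K] [LinearOrder K] [IsStrictOrderedRing K]
    [FloorRing K] (v : K) (n : ℕ) :
    (∃ a : ℤ, ((GenContFract.of v).contsAux n).a = a) ∧
      ∃ b : ℤ, ((GenContFract.of v).contsAux n).b = b := by
  induction n using Nat.strong_induction_on with
  | _ n ih =>
    match n with
    | 0 => exact ⟨⟨1, by simp⟩, ⟨0, by simp⟩⟩
    | 1 => exact ⟨⟨⌊v⌋, by simp⟩, ⟨1, by simp⟩⟩
    | m + 2 =>
      obtain ⟨⟨a, ha⟩, ⟨b, hb⟩⟩ := ih m (by omega)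
      obtain ⟨⟨a', ha'⟩, ⟨b', hb'⟩⟩ := ih (m + 1) (by omega)
      rcases hs : (GenContFract.of v).s.get? m with _ | gp
      · simp only [GenContFract.contsAux, hs]
        exact ⟨⟨a', ha'⟩, ⟨b', hb'⟩⟩
      · obtain ⟨hnum, z, hden⟩ := GenContFract.of_partNum_eq_one_and_exists_int_partDen_eq hs
        rw [GenContFract.contsAux_recurrence hs rfl rfl, hnum, hden, ha, hb, ha', hb']
        exact ⟨⟨z * a' + 1 * a, by push_cast; ring⟩, ⟨z * b' + 1 * b, by push_cast; ring⟩⟩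

/-- `α` is within `1 / (q Q)` of a reduced fraction `p / q`. For a convergent denominator `q` of
`α` this holds with `Q` the next denominator. -/
def IsReducedApprox (α Q : ℝ) (q : ℕ) : Prop :=
  ∃ p : ℤ, IsCoprime p q ∧ |α - p / q| ≤ 1 / (q * Q)

theorem isReducedApprox_of_convDen_eq {α : ℝ} (hα : Irrational α) {n q : ℕ}
    (hq : convDen α n = q) : IsReducedApprox α (convDen α (n + 1)) q := by
  have hterm := not_terminatedAt_of_irrational hα n
  change (GenContFract.of α).dens n = q at hq
  obtain ⟨p, hp⟩ := (exists_int_eq_contsAux α (n + 1)).1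
  obtain ⟨⟨p', hp'⟩, ⟨q', hq'⟩⟩ := exists_int_eq_contsAux α (n + 1 + 1)
  refine ⟨p, ?_, ?_⟩
  · have hdet : (GenContFract.of α).nums n * (GenContFract.of α).dens (n + 1) -
        (GenContFract.of α).dens n * (GenContFract.of α).nums (n + 1) = (-1) ^ (n + 1) :=
      SimpContFract.determinant (s := SimpContFract.of α) hterm
    rw [hq, show (GenContFract.of α).nums n = p from hp,
      show (GenContFract.of α).nums (n + 1) = p' from hp',
      show (GenContFract.of α).dens (n + 1) = q' from hq'] at hdet
    have hdet' : p * q' - q * p' = (-1 : ℤ) ^ (n + 1) := by exact_mod_cast hdet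
    have hsq : ((-1 : ℤ) ^ (n + 1)) * (-1) ^ (n + 1) = 1 := by rw [← mul_pow]; simp
    exact ⟨(-1) ^ (n + 1) * q', -((-1) ^ (n + 1) * p'), by
      linear_combination hsq + (-1 : ℤ) ^ (n + 1) * hdet'⟩
  · have happrox := GenContFract.abs_sub_convs_le hterm
    rwa [GenContFract.conv_eq_num_div_den, hq,
      show (GenContFract.of α).nums n = p from hp] at happrox

/-! ### Small divisors -/

theorem fourier_apply_add (k : ℤ) (x y : UnitAddCircle) :
    (fourier k (x + y) : ℂ) = fourier k x * fourier k y := by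
  simp only [fourier_apply, smul_add, AddCircle.toCircle_add, Circle.coe_mul]

theorem fourier_apply_nsmul (k : ℤ) (n : ℕ) (x : UnitAddCircle) :
    (fourier k (n • x) : ℂ) = fourier k x ^ n := by
  rw [fourier_apply, fourier_apply, smul_comm, AddCircle.toCircle_nsmul, Circle.coe_pow]

theorem norm_fourier_apply (k : ℤ) (x : UnitAddCircle) : ‖(fourier k x : ℂ)‖ = 1 :=
  Circle.norm_coe _

theorem fourier_coe_eq_exp (k m : ℤ) (x : ℝ) :
    (fourier k (x : UnitAddCircle) : ℂ)
      = Complex.exp (Complex.I * (2 * Real.pi * (k * x - m) : ℝ)) := by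
  rw [fourier_coe_apply, Complex.exp_eq_exp_iff_exists_int]
  exact ⟨m, by push_cast; ring⟩

theorem norm_fourier_sub_one_le_abs_sub (k m : ℤ) (x : ℝ) :
    ‖(fourier k (x : UnitAddCircle) : ℂ) - 1‖ ≤ 2 * Real.pi * |k * x - m| := by
  rw [fourier_coe_eq_exp k m]
  refine Real.norm_exp_I_mul_ofReal_sub_one_le.trans_eq ?_
  rw [Real.norm_eq_abs, abs_mul, abs_of_pos Real.two_pi_pos]

theorem norm_fourier_sub_one_le (k : ℤ) (x : ℝ) :
    ‖(fourier k (x : UnitAddCircle) : ℂ) - 1‖ ≤ 2 * Real.pi * (|(k : ℝ)| * |x|) := by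
  simpa [abs_mul] using norm_fourier_sub_one_le_abs_sub k 0 x

theorem le_norm_fourier_sub_one (k : ℤ) (x : ℝ) :
    4 * |k * x - round (k * x)| ≤ ‖(fourier k (x : UnitAddCircle) : ℂ) - 1‖ := by
  set u : ℝ := k * x - round (k * x)
  have hu : |u| ≤ 1 / 2 := abs_sub_round _
  have habs : |Real.pi * u| = Real.pi * |u| := by rw [abs_mul, abs_of_pos Real.pi_pos]
  have hsin : 2 / Real.pi * (Real.pi * |u|) ≤ |Real.sin (Real.pi * u)| := by
    rw [← habs]
    exact Real.mul_abs_le_abs_sin (by rw [habs]; nlinarith [Real.pi_pos])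
  rw [fourier_coe_eq_exp k (round (k * x)), Complex.norm_exp_I_mul_ofReal_sub_one, norm_mul,
    Real.norm_eq_abs, Real.norm_eq_abs, abs_two, mul_assoc, mul_div_cancel_left₀ _ two_ne_zero]
  calc 4 * |u| = 2 * (2 / Real.pi * (Real.pi * |u|)) := by field_simp; ring
    _ ≤ _ := by gcongr

namespace IsReducedApprox

variable {α Q : ℝ} {q : ℕ}

theorem norm_fourier_sub_one_le (h : IsReducedApprox α Q q) (hq : 0 < q) :
    ‖(fourier (q : ℤ) (α : UnitAddCircle) : ℂ) - 1‖ ≤ 2 * Real.pi / Q := by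
  obtain ⟨p, -, hp⟩ := h
  have hq' : (0 : ℝ) < q := by exact_mod_cast hq
  refine (norm_fourier_sub_one_le_abs_sub q p α).trans ?_
  calc 2 * Real.pi * |((q : ℤ) : ℝ) * α - p| = 2 * Real.pi * (q * |α - p / q|) := by
        rw [Int.cast_natCast, ← abs_of_pos hq', ← abs_mul, abs_of_pos hq', mul_sub,
          mul_div_cancel₀ _ hq'.ne']
    _ ≤ 2 * Real.pi * (q * (1 / (q * Q))) := by gcongr
    _ = 2 * Real.pi / Q := by field_simp

theorem three_div_le_norm_fourier_sub_one (h : IsReducedApprox α Q q) (hq : 0 < q) (hQ : 0 < Q)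
    {k : ℤ} (hk : ¬ (q : ℤ) ∣ k) (hkQ : |(k : ℝ)| ≤ Q / 4) :
    3 / q ≤ ‖(fourier k (α : UnitAddCircle) : ℂ) - 1‖ := by
  obtain ⟨p, hcoprime, hp⟩ := h
  have hq' : (0 : ℝ) < q := by exact_mod_cast hq
  set m : ℤ := round (k * α)
  have hnear : |k * p / q - k * α| ≤ 1 / (4 * q) := by
    calc |k * p / q - k * α| = |(k : ℝ)| * |α - p / q| := by
          rw [abs_sub_comm, ← abs_mul]; congr 1; ring
      _ ≤ Q / 4 * (1 / (q * Q)) := by gcongr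
      _ = 1 / (4 * q) := by field_simp
  have hfar : 1 / (q : ℝ) ≤ |(k * p / q - m : ℝ)| := by
    have hne : k * p - q * m ≠ 0 := fun h0 =>
      hk (hcoprime.symm.dvd_of_dvd_mul_right ⟨m, by linarith⟩)
    have hone : (1 : ℝ) ≤ |((k * p - q * m : ℤ) : ℝ)| := by exact_mod_cast Int.one_le_abs hne
    have e : (k * p / q - m : ℝ) = ((k * p - q * m : ℤ) : ℝ) / q := by
      push_cast; field_simp
    rw [e, abs_div, abs_of_pos hq']
    gcongr
  have htri : |(k * p / q - m : ℝ)| ≤ |k * p / q - k * α| + |k * α - m| := abs_sub_le _ _ _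
  have hround := le_norm_fourier_sub_one k α
  have e : 3 / (q : ℝ) = 4 * (1 / q - 1 / (4 * q)) := by field_simp; norm_num
  linarith

end IsReducedApprox

/-! ### Geometric sums -/

section GeomSum

variable {R : Type*} [SeminormedRing R] [NormOneClass R] {z : R}

theorem norm_geom_sum_le (hz : ‖z‖ ≤ 1) (n : ℕ) : ‖∑ i ∈ Finset.range n, z ^ i‖ ≤ n := by
  refine (norm_sum_le_of_le _ fun i _ => (norm_pow_le z i).trans (pow_le_one₀ ?_ hz)).trans ?_
  · exact norm_nonneg z
  · simp

theorem norm_geom_sum_mul_le (hz : ‖z‖ ≤ 1) (n : ℕ) :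
    ‖(∑ i ∈ Finset.range n, z ^ i) * (z - 1)‖ ≤ 2 := by
  rw [geom_sum_mul]
  refine (norm_sub_le _ _).trans ?_
  rw [norm_one]
  linarith [(norm_pow_le z n).trans (pow_le_one₀ (norm_nonneg z) hz)]

theorem norm_geom_sum_sub_le (hz : ‖z‖ ≤ 1) (n : ℕ) :
    ‖∑ i ∈ Finset.range n, z ^ i - n‖ ≤ n ^ 2 * ‖z - 1‖ := by
  have hterm : ∀ i ∈ Finset.range n, ‖z ^ i - 1‖ ≤ n * ‖z - 1‖ := by
    intro i hi
    rw [← geom_sum_mul]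
    refine (norm_mul_le _ _).trans ?_
    gcongr
    exact (norm_geom_sum_le hz i).trans (Nat.cast_le.mpr (Finset.mem_range.mp hi).le)
  calc ‖∑ i ∈ Finset.range n, z ^ i - n‖ = ‖∑ i ∈ Finset.range n, (z ^ i - 1)‖ := by simp
    _ ≤ ∑ _i ∈ Finset.range n, n * ‖z - 1‖ := norm_sum_le_of_le _ hterm
    _ = n ^ 2 * ‖z - 1‖ := by simp; ring

end GeomSum

theorem IsReducedApprox.norm_geom_sum_fourier_le {α Q : ℝ} {q : ℕ} (h : IsReducedApprox α Q q)
    (hq : 0 < q) (hQ : 0 < Q) {k : ℤ} (hk : ¬ (q : ℤ) ∣ k) (n : ℕ) :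
    ‖∑ i ∈ Finset.range n, (fourier k (α : UnitAddCircle) : ℂ) ^ i‖
      ≤ q + n * (4 / Q) * |(k : ℝ)| := by
  have hz : ‖(fourier k (α : UnitAddCircle) : ℂ)‖ ≤ 1 := (norm_fourier_apply k _).le
  have hq' : (0 : ℝ) < q := by exact_mod_cast hq
  rcases le_or_gt |(k : ℝ)| (Q / 4) with hkQ | hkQ
  · refine le_add_of_le_of_nonneg ?_ (by positivity)
    have hprod := norm_geom_sum_mul_le hz n
    rw [norm_mul] at hprod
    have hdiv := (mul_le_mul_of_nonneg_left
      (h.three_div_le_norm_fourier_sub_one hq hQ hk hkQ) (norm_nonneg _)).trans hprod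
    rw [mul_div_assoc', div_le_iff₀ hq'] at hdiv
    linarith
  · have hone : 1 ≤ 4 / Q * |(k : ℝ)| := by
      rw [div_mul_eq_mul_div, le_div_iff₀ hQ]; linarith
    refine (norm_geom_sum_le hz n).trans ?_
    rw [mul_assoc]
    exact le_add_of_nonneg_of_le hq'.le (le_mul_of_one_le_right n.cast_nonneg hone)

/-! ### Fourier coefficients of the roof -/

/-- `∑_k |a_k| |k|^m`, which controls the `m`-th derivative of `f`. It is only meaningful when
the series converges. -/
def coeffMoment (f : UnitAddCircle → ℝ) (m : ℕ) : ℝ :=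
  ∑' k : ℤ, ‖coeff f k‖ * |(k : ℝ)| ^ m

theorem coeffMoment_nonneg (f : UnitAddCircle → ℝ) (m : ℕ) : 0 ≤ coeffMoment f m :=
  tsum_nonneg fun _ => by positivity

theorem fourierTail_nonneg (f : UnitAddCircle → ℝ) (n : ℕ) : 0 ≤ fourierTail f n :=
  tsum_nonneg fun _ => by positivity

theorem coeff_neg (f : UnitAddCircle → ℝ) (k : ℤ) :
    coeff f (-k) = (starRingEnd ℂ) (coeff f k) := by
  simp only [coeff, fourierCoeff, ← integral_conj, smul_eq_mul, map_mul, neg_neg, fourier_neg,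
    RCLike.conj_conj, Complex.conj_ofReal]

theorem norm_coeff_neg (f : UnitAddCircle → ℝ) (k : ℤ) : ‖coeff f (-k)‖ = ‖coeff f k‖ := by
  rw [coeff_neg, RCLike.norm_conj]

theorem norm_coeff_le_integral {f : UnitAddCircle → ℝ} (hf : ∀ x, 0 ≤ f x) (k : ℤ) :
    ‖coeff f k‖ ≤ ∫ x, f x := by
  refine (norm_integral_le_integral_norm _).trans_eq ?_
  rw [AddCircle.integral_haarAddCircle, inv_one, one_smul]
  refine integral_congr_ae (.of_forall fun x => ?_)
  simp only [norm_smul, norm_fourier_apply, one_mul, Complex.norm_real, Real.norm_of_nonneg (hf x)]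

theorem summable_norm_coeff_mul_pow_of_le {f : UnitAddCircle → ℝ} {m m' : ℕ} (hm : m ≤ m')
    (hsum : Summable fun k : ℤ => ‖coeff f k‖ * |(k : ℝ)| ^ m') :
    Summable fun k : ℤ => ‖coeff f k‖ * |(k : ℝ)| ^ m := by
  refine .of_norm_bounded_eventually hsum ((Set.finite_singleton (0 : ℤ)).subset fun k hk => ?_)
  by_contra hk0
  have hone : (1 : ℝ) ≤ |(k : ℝ)| := by exact_mod_cast Int.one_le_abs hk0
  refine hk ?_
  change ‖‖coeff f k‖ * |(k : ℝ)| ^ m‖ ≤ _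
  rw [Real.norm_of_nonneg (by positivity)]
  gcongr

theorem hasSum_coeff_mul_fourier {f : UnitAddCircle → ℝ} (hf : Continuous f)
    (hsum : Summable (coeff f)) (x : UnitAddCircle) :
    HasSum (fun k : ℤ => coeff f k * fourier k x) (f x : ℂ) :=
  has_pointwise_sum_fourier_series_of_summable
    (f := (⟨fun x => (f x : ℂ), Complex.continuous_ofReal.comp hf⟩ : C(UnitAddCircle, ℂ))) hsum x

/-! ### Increments of Birkhoff sums -/

theorem birkhoff_natCast (α : ℝ) (f : UnitAddCircle → ℝ) (n : ℕ) (x : UnitAddCircle) :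
    birkhoff α f n x = ∑ i ∈ Finset.range n, f (x + i • (α : UnitAddCircle)) := by
  induction n with
  | zero => simp [birkhoff_zero]
  | succ n ih =>
    push_cast
    rw [birkhoff_add_one, ih, Finset.sum_range_succ, natCast_zsmul]

theorem hasSum_birkhoff {f : UnitAddCircle → ℝ} (hf : Continuous f) (hsum : Summable (coeff f))
    (α : ℝ) (n : ℕ) (x : UnitAddCircle) :
    HasSum (fun k : ℤ => coeff f k * (∑ i ∈ Finset.range n, (fourier k (α : UnitAddCircle) : ℂ) ^ i)
      * fourier k x) (birkhoff α f n x : ℂ) := by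
  rw [birkhoff_natCast, Complex.ofReal_sum]
  convert hasSum_sum (f := fun (i : ℕ) (k : ℤ) => coeff f k *
    (fourier k (x + i • (α : UnitAddCircle)) : ℂ)) (s := Finset.range n)
    (fun i _ => hasSum_coeff_mul_fourier hf hsum (x + i • (α : UnitAddCircle))) using 2 with k
  rw [Finset.mul_sum, Finset.sum_mul]
  refine Finset.sum_congr rfl fun i _ => ?_
  rw [fourier_apply_add, fourier_apply_nsmul]
  ring

theorem hasSum_int_of_even {E : Type*} [AddCommGroup E] [TopologicalSpace E]
    [IsTopologicalAddGroup E] {g : ℤ → E} {s : E} (heven : ∀ j, g (-j) = g j) (h₀ : g 0 = 0)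
    (h₁ : g 1 = 0) (hs : HasSum (fun j : ℕ => g ((j + 2 : ℕ) : ℤ)) s) : HasSum g (s + s) := by
  have hnat : HasSum (fun j : ℕ => g j) s := by
    rw [← hasSum_nat_add_iff' 2]
    simpa [Finset.sum_range_succ, h₀, h₁] using hs
  have hneg : HasSum (fun j : ℕ => g (-j)) s := by simpa only [heven] using hnat
  simpa [h₀] using hnat.of_nat_of_neg hneg

/-- The multiples of `q` other than `± q`: the frequencies whose Birkhoff sums resonate together
with those of `q` and `-q`. -/
def higherMultiples (q : ℕ) : Set ℤ := {k | (q : ℤ) ∣ k ∧ k ≠ q ∧ k ≠ -q}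

theorem mul_mem_higherMultiples_iff {q : ℕ} (hq : 0 < q) {j : ℤ} :
    j * q ∈ higherMultiples q ↔ j ≠ 1 ∧ j ≠ -1 := by
  have hq' : (q : ℤ) ≠ 0 := by exact_mod_cast hq.ne'
  have hone : j * q = q ↔ j = 1 := mul_eq_right₀ hq'
  have hneg : j * q = -q ↔ j = -1 := by rw [← neg_one_mul (q : ℤ), mul_left_inj' hq']
  simp only [higherMultiples, Set.mem_ofPred_eq, dvd_mul_left, true_and, ne_eq, hone, hneg]

theorem hasSum_higherMultiples {f : UnitAddCircle → ℝ}
    (hsum : Summable fun k : ℤ => ‖coeff f k‖ * |(k : ℝ)|) {q : ℕ} (hq : 0 < q) :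
    HasSum ((higherMultiples q).indicator fun k : ℤ => ‖coeff f k‖ * |(k : ℝ)|)
      (2 * fourierTail f q) := by
  set g : ℤ → ℝ := (higherMultiples q).indicator fun k : ℤ => ‖coeff f k‖ * |(k : ℝ)|
  have hinj : Function.Injective fun j : ℤ => j * (q : ℤ) :=
    mul_left_injective₀ (by exact_mod_cast hq.ne')
  have hg_zero : ∀ k ∉ Set.range fun j : ℤ => j * (q : ℤ), g k = 0 := by
    refine fun k hk => Set.indicator_of_notMem ?_ _
    rintro ⟨⟨j, rfl⟩, -⟩
    exact hk ⟨j, mul_comm _ _⟩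
  have hg (j : ℤ) : g (j * q)
      = if j ≠ 1 ∧ j ≠ -1 then ‖coeff f (j * q)‖ * |((j * q : ℤ) : ℝ)| else 0 := by
    split_ifs with hj
    exacts [Set.indicator_of_mem ((mul_mem_higherMultiples_iff hq).mpr hj) _,
      Set.indicator_of_notMem (mt (mul_mem_higherMultiples_iff hq).mp hj) _]
  have hg_even (j : ℤ) : g (-j * q) = g (j * q) := by
    have hne : (-j ≠ 1 ∧ -j ≠ -1) ↔ (j ≠ 1 ∧ j ≠ -1) := by omega
    rw [hg, hg]
    simp only [hne, neg_mul, norm_coeff_neg, Int.cast_neg, abs_neg]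
  have hg_tail (j : ℕ) : g (((j + 2 : ℕ) : ℤ) * q)
      = ‖coeff f (((j + 2) * q : ℕ) : ℤ)‖ * |((((j + 2) * q : ℕ) : ℤ) : ℝ)| := by
    rw [hg, if_pos (by omega), ← Nat.cast_mul]
  have hsum_tail : HasSum (fun j : ℕ => g (((j + 2 : ℕ) : ℤ) * q)) (fourierTail f q) := by
    have hinj_tail : Function.Injective fun j : ℕ => (((j + 2) * q : ℕ) : ℤ) :=
      Nat.cast_injective.comp ((mul_left_injective₀ hq.ne').comp (add_left_injective 2))
    simpa only [hg_tail, fourierTail, Function.comp_def, Int.cast_natCast, Nat.abs_cast]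
      using (hsum.comp_injective hinj_tail).hasSum
  rw [← hinj.hasSum_iff hg_zero, two_mul]
  exact hasSum_int_of_even hg_even (by simpa using hg 0) (by simpa using hg 1) hsum_tail

/-- The contribution of the frequency `k` to `S_n(f)(x + h) - S_n(f)(x)`. -/
def incrementTerm (α : ℝ) (f : UnitAddCircle → ℝ) (n : ℕ) (h : ℝ) (x : UnitAddCircle) (k : ℤ) : ℂ :=
  coeff f k * (∑ i ∈ Finset.range n, (fourier k (α : UnitAddCircle) : ℂ) ^ i)
    * (fourier k (h : UnitAddCircle) - 1) * fourier k x

theorem hasSum_incrementTerm {f : UnitAddCircle → ℝ} (hf : Continuous f)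
    (hsum : Summable (coeff f)) (α : ℝ) (n : ℕ) (h : ℝ) (x : UnitAddCircle) :
    HasSum (incrementTerm α f n h x)
      ((birkhoff α f n (x + h) - birkhoff α f n x : ℝ) : ℂ) := by
  rw [Complex.ofReal_sub]
  refine (congrArg (HasSum · _) (funext fun k => ?_)).mpr
    ((hasSum_birkhoff hf hsum α n (x + h)).sub (hasSum_birkhoff hf hsum α n x))
  rw [incrementTerm, fourier_apply_add]
  ring

theorem incrementTerm_neg (α : ℝ) (f : UnitAddCircle → ℝ) (n : ℕ) (h : ℝ) (x : UnitAddCircle)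
    (k : ℤ) :
    incrementTerm α f n h x (-k) = (starRingEnd ℂ) (incrementTerm α f n h x k) := by
  simp only [incrementTerm, coeff_neg, fourier_neg, map_mul, map_sum, map_pow, map_sub, map_one]

theorem norm_incrementTerm_le (α : ℝ) (f : UnitAddCircle → ℝ) (n : ℕ) (h : ℝ) (x : UnitAddCircle)
    (k : ℤ) {D : ℝ}
    (hD : ‖∑ i ∈ Finset.range n, (fourier k (α : UnitAddCircle) : ℂ) ^ i‖ ≤ D) :
    ‖incrementTerm α f n h x k‖ ≤ 2 * Real.pi * |h| * (D * (‖coeff f k‖ * |(k : ℝ)|)) := by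
  have hD₀ : 0 ≤ D := (norm_nonneg _).trans hD
  rw [incrementTerm, norm_mul, norm_fourier_apply, mul_one, norm_mul, norm_mul]
  calc _ ≤ ‖coeff f k‖ * D * (2 * Real.pi * (|(k : ℝ)| * |h|)) := by
        gcongr
        exact norm_fourier_sub_one_le k h
    _ = _ := by ring

/-- An upper bound, up to the factor `2π |h|`, for the total contribution of all frequencies other
than `± q` to an increment `S_n(f)(x + h) - S_n(f)(x)`, when `q` is the denominator of an
approximation of quality `Q`. -/
def offResonantBound (f : UnitAddCircle → ℝ) (Q : ℝ) (q n : ℕ) : ℝ :=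
  n * (2 * fourierTail f q) + q * coeffMoment f 1 + n * (4 / Q) * coeffMoment f 2

section Increment

variable {f : UnitAddCircle → ℝ} {α Q : ℝ} {q : ℕ}

theorem norm_incrementTerm_le_of_ne (happrox : IsReducedApprox α Q q) (hq : 0 < q) (hQ : 0 < Q)
    (n : ℕ) (h : ℝ) (x : UnitAddCircle) {k : ℤ} (hk : k ≠ q) (hk' : k ≠ -q) :
    ‖incrementTerm α f n h x k‖ ≤ 2 * Real.pi * |h| *
      (n * (higherMultiples q).indicator (fun k : ℤ => ‖coeff f k‖ * |(k : ℝ)|) k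
        + q * (‖coeff f k‖ * |(k : ℝ)| ^ 1) + n * (4 / Q) * (‖coeff f k‖ * |(k : ℝ)| ^ 2)) := by
  by_cases hdvd : (q : ℤ) ∣ k
  · refine (norm_incrementTerm_le α f n h x k
      (norm_geom_sum_le (norm_fourier_apply _ _).le n)).trans ?_
    have hmem : k ∈ higherMultiples q := ⟨hdvd, hk, hk'⟩
    rw [Set.indicator_of_mem hmem, add_assoc]
    gcongr
    exact le_add_of_nonneg_right (by positivity)
  · refine (norm_incrementTerm_le α f n h x k
      (happrox.norm_geom_sum_fourier_le hq hQ hdvd n)).trans_eq ?_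
    have hmem : k ∉ higherMultiples q := fun hmem => hdvd hmem.1
    rw [Set.indicator_of_notMem hmem]
    ring

theorem norm_sub_incrementTerm_le (hf : Continuous f)
    (hsum : Summable fun k : ℤ => ‖coeff f k‖ * |(k : ℝ)| ^ 2)
    (happrox : IsReducedApprox α Q q) (hq : 0 < q) (hQ : 0 < Q) (n : ℕ) (h : ℝ)
    (x : UnitAddCircle) :
    ‖((birkhoff α f n (x + h) - birkhoff α f n x : ℝ) : ℂ)
        - incrementTerm α f n h x q - incrementTerm α f n h x (-q)‖
      ≤ 2 * Real.pi * |h| * offResonantBound f Q q n := by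
  set b := incrementTerm α f n h x
  have hqq : -(q : ℤ) ≠ q := by omega
  have hcoeff : Summable (coeff f) := .of_norm <| by
    simpa using summable_norm_coeff_mul_pow_of_le (Nat.zero_le 2) hsum
  have hsum₁ := summable_norm_coeff_mul_pow_of_le one_le_two hsum
  have hmajorant := (((hasSum_higherMultiples (by simpa using hsum₁) hq).mul_left (n : ℝ)).add
    (hsum₁.hasSum.mul_left (q : ℝ))).add (hsum.hasSum.mul_left (n * (4 / Q)))
  have hincr := hasSum_ite_sub_hasSum
    (hasSum_ite_sub_hasSum (hasSum_incrementTerm hf hcoeff α n h x) (q : ℤ)) (-(q : ℤ))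
  rw [if_neg hqq] at hincr
  rw [← hincr.tsum_eq]
  refine tsum_of_norm_bounded (hmajorant.mul_left (2 * Real.pi * |h|)) fun k => ?_
  have hbound_nonneg : 0 ≤ 2 * Real.pi * |h| *
      (n * (higherMultiples q).indicator (fun k : ℤ => ‖coeff f k‖ * |(k : ℝ)|) k
        + q * (‖coeff f k‖ * |(k : ℝ)| ^ 1) + n * (4 / Q) * (‖coeff f k‖ * |(k : ℝ)| ^ 2)) := by
    have : 0 ≤ (higherMultiples q).indicator (fun k : ℤ => ‖coeff f k‖ * |(k : ℝ)|) k :=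
      Set.indicator_apply_nonneg fun _ => by positivity
    positivity
  by_cases hk' : k = -q
  · rwa [if_pos hk', norm_zero]
  by_cases hk : k = q
  · rwa [if_neg hk', if_pos hk, norm_zero]
  rw [if_neg hk', if_neg hk]
  exact norm_incrementTerm_le_of_ne happrox hq hQ n h x hk hk'

theorem norm_incrementTerm_sub_le (happrox : IsReducedApprox α Q q) (hq : 0 < q) (n : ℕ) {h : ℝ}
    (hqh : 2 * Real.pi * (q * |h|) ≤ 1) (x : UnitAddCircle) :
    ‖incrementTerm α f n h x q
        - (n * (2 * Real.pi * q * h) : ℝ) * (coeff f q * fourier (q : ℤ) x * Complex.I)‖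
      ≤ ‖coeff f q‖ * (n ^ 2 * (2 * Real.pi / Q) * (2 * Real.pi * (q * |h|))
        + n * (2 * Real.pi * (q * |h|)) ^ 2) := by
  set D : ℂ := ∑ i ∈ Finset.range n, (fourier (q : ℤ) (α : UnitAddCircle) : ℂ) ^ i
  set E : ℂ := fourier (q : ℤ) (h : UnitAddCircle) - 1 with hE
  set ω : ℂ := Complex.I * (2 * Real.pi * (q * h) : ℝ) with hω
  have hω_norm : ‖ω‖ = 2 * Real.pi * (q * |h|) := by
    rw [hω, norm_mul, Complex.norm_I, one_mul, Complex.norm_real, Real.norm_eq_abs, abs_mul,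
      abs_of_pos Real.two_pi_pos, abs_mul, Nat.abs_cast]
  have hsplit : incrementTerm α f n h x q
        - (n * (2 * Real.pi * q * h) : ℝ) * (coeff f q * fourier (q : ℤ) x * Complex.I)
      = coeff f q * fourier (q : ℤ) x * ((D - n) * E + n * (E - ω)) := by
    rw [incrementTerm, hω]; push_cast; ring
  have hE_norm : ‖E‖ ≤ 2 * Real.pi * (q * |h|) := by
    simpa only [Int.cast_natCast, Nat.abs_cast] using norm_fourier_sub_one_le q h
  have hE_sub : ‖E - ω‖ ≤ (2 * Real.pi * (q * |h|)) ^ 2 := by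
    have hexp : E = Complex.exp ω - 1 := by
      rw [hE, fourier_coe_eq_exp q 0, hω]; simp
    rw [hexp, ← hω_norm]
    exact Complex.norm_exp_sub_one_sub_id_le (hω_norm.trans_le hqh)
  have hD_sub : ‖D - n‖ ≤ n ^ 2 * (2 * Real.pi / Q) :=
    (norm_geom_sum_sub_le (norm_fourier_apply _ _).le n).trans
      (by gcongr; exact happrox.norm_fourier_sub_one_le hq)
  have hbound_nonneg : 0 ≤ (n : ℝ) ^ 2 * (2 * Real.pi / Q) := (norm_nonneg _).trans hD_sub
  rw [hsplit, norm_mul, norm_mul, norm_fourier_apply, mul_one]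
  gcongr
  refine (norm_add_le _ _).trans ?_
  rw [norm_mul, norm_mul, Complex.norm_natCast]
  gcongr

theorem abs_birkhoff_increment_le (hf : Continuous f)
    (hsum : Summable fun k : ℤ => ‖coeff f k‖ * |(k : ℝ)| ^ 2)
    (happrox : IsReducedApprox α Q q) (hq : 0 < q) (hQ : 0 < Q)
    (n : ℕ) {h : ℝ} (hqh : 2 * Real.pi * (q * |h|) ≤ 1) (x : UnitAddCircle) :
    |birkhoff α f n (x + h) - birkhoff α f n x
        + 4 * Real.pi * q * h * n * (coeff f q * fourier (q : ℤ) x).im|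
      ≤ 2 * Real.pi * |h| * offResonantBound f Q q n
        + 2 * (‖coeff f q‖ * (n ^ 2 * (2 * Real.pi / Q) * (2 * Real.pi * (q * |h|))
        + n * (2 * Real.pi * (q * |h|)) ^ 2)) := by
  set b := incrementTerm α f n h x with hb
  set Δ : ℝ := birkhoff α f n (x + h) - birkhoff α f n x
  set w : ℂ := (n * (2 * Real.pi * q * h) : ℝ) * (coeff f q * fourier (q : ℤ) x * Complex.I)
    with hw
  have hw_re : 2 * w.re = -(4 * Real.pi * q * h * n * (coeff f q * fourier (q : ℤ) x).im) := by
    rw [hw, Complex.re_ofReal_mul, Complex.mul_I_re]; ring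
  have hb_re : (b (-q)).re = (b q).re := by rw [hb, incrementTerm_neg, Complex.conj_re]
  have hsplit : Δ + 4 * Real.pi * q * h * n * (coeff f q * fourier (q : ℤ) x).im
      = ((Δ : ℂ) - b q - b (-q)).re + 2 * (b q - w).re := by
    simp only [Complex.sub_re, Complex.ofReal_re]
    linarith
  rw [hsplit]
  refine (abs_add_le _ _).trans (add_le_add ?_ ?_)
  · exact (Complex.abs_re_le_norm _).trans
      (norm_sub_incrementTerm_le hf hsum happrox hq hQ n h x)
  · rw [abs_mul, abs_two]
    gcongr
    exact (Complex.abs_re_le_norm _).trans (norm_incrementTerm_sub_le happrox hq n hqh x)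

end Increment

/-! ### The special flow preserves its measure -/

theorem birkhoff_add (α : ℝ) (f : UnitAddCircle → ℝ) (n m : ℤ) (x : UnitAddCircle) :
    birkhoff α f (n + m) x = birkhoff α f n x + birkhoff α f m (x + n • (α : UnitAddCircle)) := by
  induction m using Int.induction_on with
  | zero => simp [birkhoff_zero]
  | succ m ih =>
    rw [← add_assoc, birkhoff_add_one, ih, birkhoff_add_one, add_zsmul, ← add_assoc x, add_assoc]
  | pred m ih =>
    have hleft := birkhoff_add_one α f (n + (-(m : ℤ) - 1)) x
    have hright := birkhoff_add_one α f (-(m : ℤ) - 1) (x + n • (α : UnitAddCircle))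
    rw [add_assoc, sub_add_cancel, ih, add_zsmul, ← add_assoc x] at hleft
    rw [sub_add_cancel] at hright
    linarith

theorem continuous_birkhoff (α : ℝ) {f : UnitAddCircle → ℝ} (hf : Continuous f) (n : ℤ) :
    Continuous (birkhoff α f n) := by
  unfold birkhoff
  fun_prop

theorem birkhoff_strictMono (α : ℝ) {f : UnitAddCircle → ℝ} (hpos : ∀ x, 0 < f x)
    (x : UnitAddCircle) : StrictMono fun n : ℤ => birkhoff α f n x :=
  strictMono_int_of_lt_succ fun n => by
    rw [birkhoff_add_one]
    exact lt_add_of_pos_right _ (hpos _)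

/-- The map `(x, r) ↦ (x + n α, r + t - S_n(f)(x))`, with which the time-`t` map of the special
flow agrees where the orbit crosses the roof `n` times. -/
def skewMap (α : ℝ) (f : UnitAddCircle → ℝ) (n : ℤ) (t : ℝ) (p : UnitAddCircle × ℝ) :
    UnitAddCircle × ℝ :=
  (p.1 + n • (α : UnitAddCircle), p.2 + t - birkhoff α f n p.1)

theorem skewMap_zero_zero (α : ℝ) (f : UnitAddCircle → ℝ) (p : UnitAddCircle × ℝ) :
    skewMap α f 0 0 p = p := by
  simp [skewMap, birkhoff_zero]

theorem skewMap_skewMap (α : ℝ) (f : UnitAddCircle → ℝ) (m n : ℤ) (s t : ℝ)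
    (p : UnitAddCircle × ℝ) :
    skewMap α f n s (skewMap α f m t p) = skewMap α f (m + n) (t + s) p := by
  refine Prod.ext ?_ ?_ <;> simp only [skewMap]
  · rw [add_zsmul, add_assoc]
  · rw [birkhoff_add]; ring

section MeasurePreserving

variable (α : ℝ) {f : UnitAddCircle → ℝ} (hf : Continuous f)
include hf

theorem measurableSet_flowSpace : MeasurableSet (flowSpace f) :=
  (measurableSet_le measurable_const measurable_snd).inter
    (measurableSet_lt measurable_snd (hf.measurable.comp measurable_fst))

theorem continuous_skewMap (n : ℤ) (t : ℝ) : Continuous (skewMap α f n t) := by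
  have := continuous_birkhoff α hf n
  unfold skewMap
  fun_prop

theorem measurableSet_skewMap_preimage_flowSpace (n : ℤ) (t : ℝ) :
    MeasurableSet (skewMap α f n t ⁻¹' flowSpace f) :=
  (continuous_skewMap α hf n t).measurable (measurableSet_flowSpace hf)

theorem measurePreserving_skewMap (n : ℤ) (t : ℝ) :
    MeasurePreserving (skewMap α f n t) volume volume := by
  have hbirkhoff := continuous_birkhoff α hf n
  refine (measurePreserving_add_right (volume : Measure UnitAddCircle)
    (n • (α : UnitAddCircle))).skew_product (μc := (volume : Measure ℝ))
    (g := fun x r => r + t - birkhoff α f n x) (Continuous.measurable (by fun_prop)) ?_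
  refine .of_forall fun x => ?_
  simp only [add_sub_assoc]
  exact map_add_right_eq_self volume _

variable (hpos : ∀ x, 0 < f x)
include hpos

theorem crossings_spec (x : UnitAddCircle) (s : ℝ) :
    birkhoff α f (crossings α f x s) x ≤ s ∧ s < birkhoff α f (crossings α f x s + 1) x :=
  Classical.epsilon_spec (existsUnique_crossings α hf hpos x s).exists

theorem crossings_eq_iff {x : UnitAddCircle} {s : ℝ} {n : ℤ} :
    crossings α f x s = n ↔ birkhoff α f n x ≤ s ∧ s < birkhoff α f (n + 1) x :=
  ⟨fun h => h ▸ crossings_spec α hf hpos x s, fun h =>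
    (existsUnique_crossings α hf hpos x s).unique (crossings_spec α hf hpos x s) h⟩

theorem skewMap_mem_flowSpace_iff (n : ℤ) (t : ℝ) (p : UnitAddCircle × ℝ) :
    skewMap α f n t p ∈ flowSpace f ↔ crossings α f p.1 (p.2 + t) = n := by
  rw [crossings_eq_iff α hf hpos, birkhoff_add_one]
  simp only [skewMap, flowSpace, Set.mem_ofPred_eq, sub_nonneg, sub_lt_iff_lt_add']

theorem specialFlow_eq_of_skewMap_mem {n : ℤ} {t : ℝ} {p : UnitAddCircle × ℝ}
    (h : skewMap α f n t p ∈ flowSpace f) : specialFlow α f t p = skewMap α f n t p := by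
  obtain rfl := (skewMap_mem_flowSpace_iff α hf hpos n t p).mp h
  rfl

theorem specialFlow_mem_flowSpace (t : ℝ) (p : UnitAddCircle × ℝ) :
    specialFlow α f t p ∈ flowSpace f :=
  (skewMap_mem_flowSpace_iff α hf hpos _ t p).mpr rfl

theorem specialFlow_skewMap (m : ℤ) (s t : ℝ) (p : UnitAddCircle × ℝ) :
    specialFlow α f s (skewMap α f m t p) = specialFlow α f (t + s) p := by
  have hskew : skewMap α f (crossings α f p.1 (p.2 + (t + s)) - m) s (skewMap α f m t p)
      = specialFlow α f (t + s) p := by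
    rw [skewMap_skewMap, add_sub_cancel]
    rfl
  rw [← hskew]
  refine specialFlow_eq_of_skewMap_mem α hf hpos ?_
  rw [hskew]
  exact specialFlow_mem_flowSpace α hf hpos (t + s) p

theorem specialFlow_preimage_eq_iUnion (t : ℝ) (A : Set (UnitAddCircle × ℝ)) :
    specialFlow α f t ⁻¹' A = ⋃ n : ℤ, skewMap α f n t ⁻¹' (A ∩ flowSpace f) := by
  ext p
  simp only [Set.mem_preimage, Set.mem_iUnion]
  constructor
  · exact fun h => ⟨_, h, specialFlow_mem_flowSpace α hf hpos t p⟩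
  · rintro ⟨n, hA, hF⟩
    rwa [specialFlow_eq_of_skewMap_mem α hf hpos hF]

theorem measurable_specialFlow (t : ℝ) : Measurable (specialFlow α f t) := by
  intro A hA
  rw [specialFlow_preimage_eq_iUnion α hf hpos]
  exact .iUnion fun n => (continuous_skewMap α hf n t).measurable
    (hA.inter (measurableSet_flowSpace hf))

theorem volume_eq_tsum_inter_skewMap_preimage (t : ℝ) {B : Set (UnitAddCircle × ℝ)}
    (hB : MeasurableSet B) :
    volume B = ∑' n : ℤ, volume (B ∩ skewMap α f n t ⁻¹' flowSpace f) := by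
  have hcover : B = ⋃ n : ℤ, B ∩ skewMap α f n t ⁻¹' flowSpace f := by
    rw [← Set.inter_iUnion, eq_comm, Set.inter_eq_left]
    exact fun p _ => Set.mem_iUnion.mpr ⟨_, specialFlow_mem_flowSpace α hf hpos t p⟩
  have hdisj : Pairwise (Function.onFun Disjoint fun n : ℤ =>
      B ∩ skewMap α f n t ⁻¹' flowSpace f) := by
    refine fun n m hnm => Set.disjoint_left.mpr fun p hn hm => hnm ?_
    rw [← (skewMap_mem_flowSpace_iff α hf hpos n t p).mp hn.2]
    exact (skewMap_mem_flowSpace_iff α hf hpos m t p).mp hm.2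
  conv_lhs => rw [hcover]
  exact measure_iUnion hdisj fun n =>
    hB.inter (measurableSet_skewMap_preimage_flowSpace α hf n t)

theorem skewMap_preimage_inter (n : ℤ) (t : ℝ) (A : Set (UnitAddCircle × ℝ)) :
    skewMap α f n t ⁻¹' (A ∩ flowSpace f ∩ skewMap α f (-n) (-t) ⁻¹' flowSpace f)
      = specialFlow α f t ⁻¹' A ∩ flowSpace f ∩ skewMap α f n t ⁻¹' flowSpace f := by
  ext p
  simp only [Set.mem_inter_iff, Set.mem_preimage, skewMap_skewMap, add_neg_cancel,
    skewMap_zero_zero]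
  constructor
  · rintro ⟨⟨hA, hF⟩, hp⟩
    rw [specialFlow_eq_of_skewMap_mem α hf hpos hF]
    exact ⟨⟨hA, hp⟩, hF⟩
  · rintro ⟨⟨hA, hp⟩, hF⟩
    rw [specialFlow_eq_of_skewMap_mem α hf hpos hF] at hA
    exact ⟨⟨hA, hF⟩, hp⟩

theorem measurePreserving_specialFlow (t : ℝ) :
    MeasurePreserving (specialFlow α f t) (flowMeasure f) (flowMeasure f) := by
  have hT := measurable_specialFlow α hf hpos t
  have hF := measurableSet_flowSpace hf
  refine ⟨hT, Measure.ext fun A hA => ?_⟩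
  rw [Measure.map_apply hT hA, flowMeasure, Measure.restrict_apply (hT hA),
    Measure.restrict_apply hA,
    volume_eq_tsum_inter_skewMap_preimage α hf hpos t ((hT hA).inter hF),
    volume_eq_tsum_inter_skewMap_preimage α hf hpos (-t) (hA.inter hF),
    ← (Equiv.neg ℤ).tsum_eq fun n => volume (A ∩ flowSpace f ∩ skewMap α f n (-t) ⁻¹' flowSpace f)]
  refine tsum_congr fun n => ?_
  rw [Equiv.neg_apply, ← skewMap_preimage_inter α hf hpos]
  exact ((measurePreserving_skewMap α hf n t).measure_preimage ((hA.inter hF).inter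
    (measurableSet_skewMap_preimage_flowSpace α hf (-n) (-t))).nullMeasurableSet)

end MeasurePreserving

/-! ### Test functions -/

/-- The continuous functions on `𝕋 × ℝ` that vanish off `{(x, r) : 0 < r < f x}`; they are dense
in `L²` of the phase space and stay continuous along the orbits of the special flow. -/
structure IsTestFunction (f : UnitAddCircle → ℝ) (φ : UnitAddCircle × ℝ → ℂ) : Prop where
  continuous : Continuous φ
  eq_zero : ∀ p : UnitAddCircle × ℝ, p.2 ≤ 0 ∨ f p.1 ≤ p.2 → φ p = 0

/-- The function on `𝕋 × ℝ` that takes at `(x, v)` the value of `φ` at the point which the orbit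
of `(x, 0)` reaches at time `v`. -/
def orbitLift (α : ℝ) (f : UnitAddCircle → ℝ) (φ : UnitAddCircle × ℝ → ℂ)
    (p : UnitAddCircle × ℝ) : ℂ :=
  φ (specialFlow α f 0 p)

/-- The integral of `φ` over the vertical segment from `(x, 0)` to `(x, f x)`. -/
def fibreIntegral (f : UnitAddCircle → ℝ) (φ : UnitAddCircle × ℝ → ℂ) (x : UnitAddCircle) : ℂ :=
  ∫ v in (0 : ℝ)..f x, φ (x, v)

theorem exists_roof_bounds {f : UnitAddCircle → ℝ} (hf : Continuous f) (hpos : ∀ x, 0 < f x) :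
    ∃ m M : ℝ, 0 < m ∧ ∀ x, m ≤ f x ∧ f x ≤ M := by
  obtain ⟨y, -, hy⟩ := isCompact_univ.exists_isMinOn Set.univ_nonempty hf.continuousOn
  obtain ⟨z, -, hz⟩ := isCompact_univ.exists_isMaxOn Set.univ_nonempty hf.continuousOn
  exact ⟨f y, f z, hpos y, fun x => ⟨hy (Set.mem_univ x), hz (Set.mem_univ x)⟩⟩

section TestFunction

variable (α : ℝ) {f : UnitAddCircle → ℝ} {φ : UnitAddCircle × ℝ → ℂ}

namespace IsTestFunction

theorem support_subset (hφ : IsTestFunction f φ) : Function.support φ ⊆ flowSpace f := by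
  intro p hp
  by_contra hmem
  refine hp (hφ.eq_zero p ?_)
  rw [flowSpace, Set.mem_ofPred_eq, not_and_or, not_le, not_lt] at hmem
  exact hmem.imp_left le_of_lt

theorem hasCompactSupport (hφ : IsTestFunction f φ) (hf : Continuous f) :
    HasCompactSupport φ := by
  obtain ⟨z, -, hz⟩ := isCompact_univ.exists_isMaxOn Set.univ_nonempty hf.continuousOn
  refine .intro (isCompact_univ.prod (isCompact_Icc (a := (0 : ℝ)) (b := f z))) fun p hp => ?_
  contrapose! hp
  have hmem := hφ.support_subset hp
  exact ⟨Set.mem_univ _, hmem.1, hmem.2.le.trans (hz (Set.mem_univ p.1))⟩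

theorem exists_norm_le (hφ : IsTestFunction f φ) (hf : Continuous f) : ∃ K, ∀ p, ‖φ p‖ ≤ K :=
  (hφ.hasCompactSupport hf).exists_bound_of_continuous hφ.continuous

theorem integral_flowMeasure (hφ : IsTestFunction f φ) :
    ∫ p, φ p ∂flowMeasure f = ∫ p, φ p :=
  setIntegral_eq_integral_of_forall_compl_eq_zero fun _ hp =>
    Function.notMem_support.mp fun h => hp (hφ.support_subset h)

theorem continuous_fibreIntegral (hφ : IsTestFunction f φ) (hf : Continuous f) :
    Continuous (fibreIntegral f φ) :=
  intervalIntegral.continuous_parametric_intervalIntegral_of_continuous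
    (f := fun x v => φ (x, v)) hφ.continuous hf

theorem integral_fibreIntegral (hφ : IsTestFunction f φ) (hf : Continuous f)
    (hpos : ∀ x, 0 < f x) : ∫ x, fibreIntegral f φ x = ∫ p, φ p ∂flowMeasure f := by
  rw [hφ.integral_flowMeasure, Measure.volume_eq_prod, integral_prod _
    (hφ.continuous.integrable_of_hasCompactSupport (hφ.hasCompactSupport hf))]
  refine integral_congr_ae (.of_forall fun x => ?_)
  simp only [fibreIntegral]
  rw [intervalIntegral.integral_of_le (hpos x).le]
  refine setIntegral_eq_integral_of_forall_compl_eq_zero fun v hv => hφ.eq_zero _ ?_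
  rw [Set.mem_Ioc, not_and_or, not_lt, not_le] at hv
  exact hv.imp_right le_of_lt

end IsTestFunction

section OrbitLift

variable (hf : Continuous f) (hpos : ∀ x, 0 < f x)
include hf hpos

theorem orbitLift_skewMap (φ : UnitAddCircle × ℝ → ℂ) (m : ℤ) (t : ℝ) (p : UnitAddCircle × ℝ) :
    orbitLift α f φ (skewMap α f m t p) = φ (specialFlow α f t p) := by
  rw [orbitLift, specialFlow_skewMap α hf hpos, add_zero]

theorem orbitLift_of_mem_flowSpace (φ : UnitAddCircle × ℝ → ℂ) {p : UnitAddCircle × ℝ}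
    (hp : p ∈ flowSpace f) : orbitLift α f φ p = φ p := by
  have hmem : skewMap α f 0 0 p ∈ flowSpace f := by rwa [skewMap_zero_zero]
  rw [orbitLift, specialFlow_eq_of_skewMap_mem α hf hpos hmem, skewMap_zero_zero]

theorem specialFlow_zero_eq_skewMap {n : ℤ} {p : UnitAddCircle × ℝ}
    (h₁ : birkhoff α f n p.1 ≤ p.2) (h₂ : p.2 < birkhoff α f (n + 1) p.1) :
    specialFlow α f 0 p = skewMap α f n 0 p := by
  refine specialFlow_eq_of_skewMap_mem α hf hpos
    ((skewMap_mem_flowSpace_iff α hf hpos n 0 p).mpr ?_)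
  rw [add_zero]
  exact (crossings_eq_iff α hf hpos).mpr ⟨h₁, h₂⟩

theorem IsTestFunction.continuous_orbitLift (hφ : IsTestFunction f φ) :
    Continuous (orbitLift α f φ) := by
  have hbirkhoff : ∀ m, Continuous (birkhoff α f m) := continuous_birkhoff α hf
  have hskew : ∀ m, Continuous fun p => φ (skewMap α f m 0 p) :=
    fun m => hφ.continuous.comp (continuous_skewMap α hf m 0)
  refine continuous_iff_continuousAt.mpr fun p₀ => ?_
  set n := crossings α f p₀.1 p₀.2
  have hspec := crossings_spec α hf hpos p₀.1 p₀.2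
  have hnhds : {p : UnitAddCircle × ℝ |
      birkhoff α f (n - 1) p.1 < p.2 ∧ p.2 < birkhoff α f (n + 1) p.1} ∈ 𝓝 p₀ := by
    refine IsOpen.mem_nhds ?_
      ⟨(birkhoff_strictMono α hpos p₀.1 (sub_one_lt n)).trans_le hspec.1, hspec.2⟩
    exact (isOpen_lt (by fun_prop) continuous_snd).inter (isOpen_lt continuous_snd (by fun_prop))
  have hcont : Continuous fun p => φ (skewMap α f n 0 p) + φ (skewMap α f (n - 1) 0 p) :=
    (hskew n).add (hskew (n - 1))
  refine hcont.continuousAt.congr ?_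
  filter_upwards [hnhds] with p hp
  have hstep := birkhoff_add_one α f (n - 1) p.1
  rw [sub_add_cancel] at hstep
  rcases le_or_gt (birkhoff α f n p.1) p.2 with h | h
  · have hvanish : φ (skewMap α f (n - 1) 0 p) = 0 :=
      hφ.eq_zero _ (.inr (by simp only [skewMap]; linarith))
    rw [hvanish, add_zero, orbitLift, specialFlow_zero_eq_skewMap α hf hpos h hp.2]
  · have hvanish : φ (skewMap α f n 0 p) = 0 :=
      hφ.eq_zero _ (.inl (by simp only [skewMap]; linarith))
    rw [hvanish, zero_add, orbitLift, specialFlow_zero_eq_skewMap α hf hpos hp.1.le (by simpa)]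

theorem orbitLift_sub_birkhoff (φ : UnitAddCircle × ℝ → ℂ) (n : ℤ) (x : UnitAddCircle) (v : ℝ) :
    orbitLift α f φ (x + n • (α : UnitAddCircle), v - birkhoff α f n x)
      = orbitLift α f φ (x, v) := by
  simpa only [orbitLift, skewMap, add_zero] using orbitLift_skewMap α hf hpos φ n 0 (x, v)

theorem integral_orbitLift_sub_birkhoff (φ : UnitAddCircle × ℝ → ℂ) (n : ℤ) (x : UnitAddCircle)
    (a b : ℝ) :
    ∫ v in (a - birkhoff α f n x)..(b - birkhoff α f n x),
      orbitLift α f φ (x + n • (α : UnitAddCircle), v) = ∫ v in a..b, orbitLift α f φ (x, v) := by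
  rw [← intervalIntegral.integral_comp_sub_right]
  exact intervalIntegral.integral_congr fun v _ => orbitLift_sub_birkhoff α hf hpos φ n x v

theorem integral_orbitLift_roof (φ : UnitAddCircle × ℝ → ℂ) (x : UnitAddCircle) :
    ∫ v in (0 : ℝ)..f x, orbitLift α f φ (x, v) = fibreIntegral f φ x := by
  refine intervalIntegral.integral_congr_Ioo_of_le (hpos x).le fun v hv => ?_
  exact orbitLift_of_mem_flowSpace α hf hpos φ ⟨hv.1.le, hv.2⟩

theorem IsTestFunction.integral_orbitLift_birkhoff (hφ : IsTestFunction f φ) (n : ℕ)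
    (x : UnitAddCircle) :
    ∫ v in (0 : ℝ)..birkhoff α f n x, orbitLift α f φ (x, v)
      = ∑ i ∈ Finset.range n, fibreIntegral f φ (x + i • (α : UnitAddCircle)) := by
  have hlift := hφ.continuous_orbitLift α hf hpos
  have hfibre : Continuous fun v => orbitLift α f φ (x, v) := by fun_prop
  induction n with
  | zero => simp [birkhoff_zero]
  | succ n ih =>
    rw [Finset.sum_range_succ, ← ih, ← intervalIntegral.integral_add_adjacent_intervals
      (hfibre.intervalIntegrable _ _) (hfibre.intervalIntegrable (birkhoff α f n x) _),
      ← integral_orbitLift_roof α hf hpos, ← natCast_zsmul,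
      ← integral_orbitLift_sub_birkhoff α hf hpos φ n x (birkhoff α f n x)]
    push_cast
    rw [birkhoff_add_one, sub_self, add_sub_cancel_left]

end OrbitLift

end TestFunction

/-! ### Uniform convergence of ergodic averages -/

theorem integrable_of_continuous (P : C(UnitAddCircle, ℂ)) : Integrable P volume :=
  P.continuous.integrable_of_hasCompactSupport (.of_compactSpace _)

theorem integral_fourier_of_ne_zero {k : ℤ} (hk : k ≠ 0) :
    ∫ x : UnitAddCircle, (fourier k x : ℂ) = 0 :=
  integral_eq_zero_of_add_right_eq_neg (fourier_add_half_inv_index hk one_pos)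

theorem fourier_ne_one_of_irrational {α : ℝ} (hα : Irrational α) {k : ℤ} (hk : k ≠ 0) :
    (fourier k (α : UnitAddCircle) : ℂ) ≠ 1 := by
  have hpos : 0 < |k * α - round (k * α)| :=
    abs_pos.mpr (sub_ne_zero.mpr ((hα.intCast_mul hk).ne_int _))
  intro h
  have hle := le_norm_fourier_sub_one k α
  rw [h, sub_self, norm_zero] at hle
  linarith

/-- The deviation `∑_{i < n} P (x + i α) - n ∫ P` of a Birkhoff sum from its mean. -/
def rotationDiscrepancy (α : ℝ) (n : ℕ) (x : UnitAddCircle) : C(UnitAddCircle, ℂ) →ₗ[ℂ] ℂ where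
  toFun P := ∑ i ∈ Finset.range n, P (x + i • (α : UnitAddCircle)) - n * ∫ y, P y
  map_add' P R := by
    simp only [ContinuousMap.add_apply]
    rw [integral_add (integrable_of_continuous P) (integrable_of_continuous R),
      Finset.sum_add_distrib]
    ring
  map_smul' c P := by
    simp only [ContinuousMap.smul_apply, smul_eq_mul, RingHom.id_apply]
    rw [integral_const_mul, ← Finset.mul_sum]
    ring

theorem norm_rotationDiscrepancy_le (α : ℝ) (n : ℕ) (x : UnitAddCircle)
    (P : C(UnitAddCircle, ℂ)) : ‖rotationDiscrepancy α n x P‖ ≤ 2 * n * ‖P‖ := by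
  have hsum : ‖∑ i ∈ Finset.range n, P (x + i • (α : UnitAddCircle))‖ ≤ n * ‖P‖ := by
    simpa using norm_sum_le_of_le (Finset.range n)
      fun i _ => P.norm_coe_le_norm (x + i • (α : UnitAddCircle))
  have hmean : ‖∫ y, P y‖ ≤ ‖P‖ := by
    simpa [measureReal_def] using
      norm_integral_le_of_norm_le_const (μ := volume) (.of_forall P.norm_coe_le_norm)
  refine (norm_sub_le _ _).trans ?_
  rw [norm_mul, Complex.norm_natCast, mul_assoc, two_mul]
  gcongr

theorem exists_norm_rotationDiscrepancy_fourier_le {α : ℝ} (hα : Irrational α) (k : ℤ) :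
    ∃ C, ∀ n x, ‖rotationDiscrepancy α n x (fourier k)‖ ≤ C := by
  rcases eq_or_ne k 0 with rfl | hk
  · exact ⟨0, fun n x => by simp [rotationDiscrepancy, measureReal_def]⟩
  refine ⟨2 / ‖(fourier k (α : UnitAddCircle) : ℂ) - 1‖, fun n x => ?_⟩
  have hgap : 0 < ‖(fourier k (α : UnitAddCircle) : ℂ) - 1‖ :=
    norm_pos_iff.mpr (sub_ne_zero.mpr (fourier_ne_one_of_irrational hα hk))
  simp only [rotationDiscrepancy, LinearMap.coe_mk, AddHom.coe_mk, fourier_apply_add,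
    fourier_apply_nsmul, integral_fourier_of_ne_zero hk, mul_zero, sub_zero]
  rw [← Finset.mul_sum, norm_mul, norm_fourier_apply, one_mul, le_div_iff₀ hgap, ← norm_mul]
  exact norm_geom_sum_mul_le (norm_fourier_apply _ _).le n

theorem exists_norm_rotationDiscrepancy_le_of_mem_span {α : ℝ} (hα : Irrational α)
    {P : C(UnitAddCircle, ℂ)} (hP : P ∈ Submodule.span ℂ (Set.range (@fourier 1))) :
    ∃ C, ∀ n x, ‖rotationDiscrepancy α n x P‖ ≤ C := by
  induction hP using Submodule.span_induction with
  | mem P hP =>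
    obtain ⟨k, rfl⟩ := hP
    exact exists_norm_rotationDiscrepancy_fourier_le hα k
  | zero => exact ⟨0, fun n x => by rw [map_zero, norm_zero]⟩
  | add P R _ _ hP hR =>
    obtain ⟨C, hC⟩ := hP
    obtain ⟨D, hD⟩ := hR
    exact ⟨C + D, fun n x => by rw [map_add]; exact norm_add_le_of_le (hC n x) (hD n x)⟩
  | smul c P _ hP =>
    obtain ⟨C, hC⟩ := hP
    refine ⟨‖c‖ * C, fun n x => ?_⟩
    rw [map_smul, norm_smul]
    gcongr
    exact hC n x

theorem exists_norm_rotationDiscrepancy_le {α : ℝ} (hα : Irrational α) (H : C(UnitAddCircle, ℂ))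
    {ε : ℝ} (hε : 0 < ε) : ∃ C, ∀ n x, ‖rotationDiscrepancy α n x H‖ ≤ ε * n + C := by
  have hmem : H ∈ closure
      (Submodule.span ℂ (Set.range (@fourier 1)) : Set C(UnitAddCircle, ℂ)) := by
    rw [← Submodule.topologicalClosure_coe, span_fourier_closure_eq_top]; trivial
  obtain ⟨P, hP, hHP⟩ := Metric.mem_closure_iff.mp hmem (ε / 2) (by positivity)
  obtain ⟨C, hC⟩ := exists_norm_rotationDiscrepancy_le_of_mem_span hα hP
  refine ⟨C, fun n x => ?_⟩
  calc ‖rotationDiscrepancy α n x H‖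
      = ‖rotationDiscrepancy α n x (H - P) + rotationDiscrepancy α n x P‖ := by
        rw [← map_add, sub_add_cancel]
    _ ≤ 2 * n * ‖H - P‖ + C :=
        norm_add_le_of_le (norm_rotationDiscrepancy_le α n x _) (hC n x)
    _ ≤ 2 * n * (ε / 2) + C := by
        gcongr
        rw [← dist_eq_norm]
        exact hHP.le
    _ = ε * n + C := by ring

section ErgodicAverage

variable (α : ℝ) {f : UnitAddCircle → ℝ} {φ : UnitAddCircle × ℝ → ℂ}

theorem natCast_mul_le_birkhoff {m : ℝ} (hm : ∀ x, m ≤ f x) (n : ℕ) (x : UnitAddCircle) :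
    n * m ≤ birkhoff α f n x := by
  rw [birkhoff_natCast]
  simpa using Finset.sum_le_sum fun i (_ : i ∈ Finset.range n) => hm (x + i • (α : UnitAddCircle))

theorem birkhoff_le_natCast_mul {M : ℝ} (hM : ∀ x, f x ≤ M) (n : ℕ) (x : UnitAddCircle) :
    birkhoff α f n x ≤ n * M := by
  rw [birkhoff_natCast]
  simpa using Finset.sum_le_sum fun i (_ : i ∈ Finset.range n) => hM (x + i • (α : UnitAddCircle))

theorem crossings_nonneg (hf : Continuous f) (hpos : ∀ x, 0 < f x) (x : UnitAddCircle) {s : ℝ}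
    (hs : 0 ≤ s) : 0 ≤ crossings α f x s := by
  have hlt := (crossings_spec α hf hpos x s).2
  rw [← Int.lt_add_one_iff, ← (birkhoff_strictMono α hpos x).lt_iff_lt, birkhoff_zero]
  exact hs.trans_lt hlt

variable {α}

namespace IsTestFunction

theorem exists_norm_integral_birkhoff_sub_le (hφ : IsTestFunction f φ) (hα : Irrational α)
    (hf : Continuous f) (hpos : ∀ x, 0 < f x) (hint : ∫ x, f x = 1) {ε : ℝ} (hε : 0 < ε) :
    ∃ C, ∀ (n : ℕ) (x : UnitAddCircle),
      ‖(∫ v in (0 : ℝ)..birkhoff α f n x, orbitLift α f φ (x, v))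
        - birkhoff α f n x * ∫ p, φ p ∂flowMeasure f‖ ≤ ε * n + C := by
  set c : ℂ := ∫ p, φ p ∂flowMeasure f
  let G : C(UnitAddCircle, ℂ) := ⟨fibreIntegral f φ, hφ.continuous_fibreIntegral hf⟩
  let F : C(UnitAddCircle, ℂ) := ⟨fun x => (f x : ℂ), Complex.continuous_ofReal.comp hf⟩
  obtain ⟨C, hC⟩ := exists_norm_rotationDiscrepancy_le hα (G - c • F) hε
  refine ⟨C, fun n x => (congrArg norm ?_).trans_le (hC n x)⟩
  have hG : ∫ y, G y = c := hφ.integral_fibreIntegral hf hpos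
  have hF : ∫ y, F y = 1 := by
    change ∫ y, (f y : ℂ) = 1
    rw [integral_complex_ofReal, hint, Complex.ofReal_one]
  rw [hφ.integral_orbitLift_birkhoff α hf hpos, birkhoff_natCast, map_sub, map_smul]
  simp only [rotationDiscrepancy, LinearMap.coe_mk, AddHom.coe_mk, hG, hF, smul_eq_mul]
  simp only [G, F, ContinuousMap.coe_mk]
  push_cast
  ring

theorem exists_norm_integral_zero_sub_le (hφ : IsTestFunction f φ) (hα : Irrational α)
    (hf : Continuous f) (hpos : ∀ x, 0 < f x) (hint : ∫ x, f x = 1) {ε : ℝ} (hε : 0 < ε) :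
    ∃ C, ∀ (x : UnitAddCircle) (L : ℝ), 0 ≤ L →
      ‖(∫ v in (0 : ℝ)..L, orbitLift α f φ (x, v)) - L * ∫ p, φ p ∂flowMeasure f‖
        ≤ ε * L + C := by
  obtain ⟨m, M, hm, hmM⟩ := exists_roof_bounds hf hpos
  obtain ⟨K, hK⟩ := hφ.exists_norm_le hf
  obtain ⟨C, hC⟩ := hφ.exists_norm_integral_birkhoff_sub_le hα hf hpos hint (mul_pos hε hm)
  set c : ℂ := ∫ p, φ p ∂flowMeasure f
  refine ⟨C + (K + ‖c‖) * M, fun x L hL => ?_⟩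
  obtain ⟨n, hn⟩ := Int.eq_ofNat_of_zero_le (crossings_nonneg α hf hpos x hL)
  obtain ⟨hsL, hLs⟩ := crossings_spec α hf hpos x L
  rw [hn, birkhoff_add_one] at hLs
  rw [hn] at hsL
  have hnL : n * m ≤ L := (natCast_mul_le_birkhoff α (fun x => (hmM x).1) n x).trans hsL
  have hsum := hC n x
  set s := birkhoff α f n x
  have hLs_le : |L - s| ≤ M := by
    rw [abs_of_nonneg (sub_nonneg.mpr hsL)]
    linarith [(hmM (x + (n : ℤ) • (α : UnitAddCircle))).2]
  have hlast : ‖(∫ v in s..L, orbitLift α f φ (x, v)) - ((L - s : ℝ) : ℂ) * c‖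
      ≤ (K + ‖c‖) * M := by
    rw [add_mul]
    refine norm_sub_le_of_le ?_ ?_
    · refine (intervalIntegral.norm_integral_le_of_norm_le_const fun v _ => hK _).trans ?_
      have hK₀ : 0 ≤ K := (norm_nonneg _).trans (hK 0)
      gcongr
    · rw [norm_mul, Complex.norm_real, Real.norm_eq_abs, mul_comm]
      gcongr
  have hlift := hφ.continuous_orbitLift α hf hpos
  have hfibre : Continuous fun v => orbitLift α f φ (x, v) := by fun_prop
  have hsplit : (∫ v in (0 : ℝ)..L, orbitLift α f φ (x, v)) - L * c
      = ((∫ v in (0 : ℝ)..s, orbitLift α f φ (x, v)) - s * c)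
        + ((∫ v in s..L, orbitLift α f φ (x, v)) - ((L - s : ℝ) : ℂ) * c) := by
    rw [← intervalIntegral.integral_add_adjacent_intervals
      (hfibre.intervalIntegrable 0 s) (hfibre.intervalIntegrable s L)]
    push_cast; ring
  rw [hsplit]
  refine (norm_add_le_of_le hsum hlast).trans ?_
  linarith [mul_le_mul_of_nonneg_left hnL hε.le]

theorem exists_norm_integral_sub_le (hφ : IsTestFunction f φ) (hα : Irrational α)
    (hf : Continuous f) (hpos : ∀ x, 0 < f x) (hint : ∫ x, f x = 1) {ε : ℝ} (hε : 0 < ε) :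
    ∃ C, ∀ (x : UnitAddCircle) (v L : ℝ), 0 ≤ L →
      ‖(∫ u in v..(v + L), orbitLift α f φ (x, u)) - L * ∫ p, φ p ∂flowMeasure f‖
        ≤ ε * L + C := by
  obtain ⟨m, M, -, hmM⟩ := exists_roof_bounds hf hpos
  obtain ⟨C, hC⟩ := hφ.exists_norm_integral_zero_sub_le hα hf hpos hint hε
  refine ⟨2 * ε * M + 2 * C, fun x v L hL => ?_⟩
  set c : ℂ := ∫ p, φ p ∂flowMeasure f
  set n := crossings α f x v with hn
  obtain ⟨hv, hv'⟩ := crossings_spec α hf hpos x v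
  rw [← hn, birkhoff_add_one] at hv'
  set y := x + n • (α : UnitAddCircle)
  obtain ⟨w, hw⟩ : ∃ w, w = v - birkhoff α f n x := ⟨_, rfl⟩
  have hw₀ : 0 ≤ w := by rw [hw]; exact sub_nonneg.mpr hv
  have hwM : w ≤ M := by linarith [(hmM y).2]
  have hlift := hφ.continuous_orbitLift α hf hpos
  have hfibre : Continuous fun u => orbitLift α f φ (y, u) := by fun_prop
  have hsplit : (∫ u in v..(v + L), orbitLift α f φ (x, u)) - L * c
      = ((∫ u in (0 : ℝ)..(w + L), orbitLift α f φ (y, u)) - (w + L : ℝ) * c)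
        - ((∫ u in (0 : ℝ)..w, orbitLift α f φ (y, u)) - w * c) := by
    rw [← integral_orbitLift_sub_birkhoff α hf hpos φ n x, ← hw, add_sub_right_comm, ← hw,
      ← intervalIntegral.integral_add_adjacent_intervals
      (hfibre.intervalIntegrable 0 w) (hfibre.intervalIntegrable w (w + L))]
    push_cast; ring
  rw [hsplit]
  refine (norm_sub_le_of_le (hC y _ (by positivity)) (hC y w hw₀)).trans ?_
  linarith [mul_le_mul_of_nonneg_left hwM hε.le]

end IsTestFunction

end ErgodicAverage

/-! ### Resonant times -/

section Resonance

variable {α : ℝ} {f : UnitAddCircle → ℝ} {t : ℕ → ℝ} {q : ℕ → ℕ} {Q : ℕ → ℝ}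

/-- Times `t_j → ∞` and frequencies `q_j` such that, up to times of order `t_j`, the frequency
`q_j` governs the oscillation of the Birkhoff sums of `f` over the rotation by `α`: the point
`q_j α` is within `1 / Q_j` of an integer, where `t_j / Q_j → 0`. -/
structure IsResonant (α : ℝ) (f : UnitAddCircle → ℝ) (t : ℕ → ℝ) (q : ℕ → ℕ) (Q : ℕ → ℝ) :
    Prop where
  freq_pos : ∀ j, 0 < q j
  Q_pos : ∀ j, 0 < Q j
  time_pos : ∀ j, 0 < t j
  isReducedApprox : ∀ j, IsReducedApprox α (Q j) (q j)
  coeff_ne_zero : ∀ j, coeff f (q j) ≠ 0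
  tendsto_time : Tendsto t atTop atTop
  tendsto_tail : Tendsto (fun j => fourierTail f (q j) / ‖coeff f (q j)‖) atTop (𝓝 0)
  tendsto_amplitude : Tendsto (fun j => t j * ‖coeff f (q j)‖) atTop atTop
  tendsto_ratio : Tendsto (fun j => t j / Q j) atTop (𝓝 0)

/-- The largest horizontal displacement used at the time `T` and the frequency `q`: it moves the
Birkhoff sums of length `T` by an amount of order `S`. -/
def displacement (f : UnitAddCircle → ℝ) (S T : ℝ) (q : ℕ) : ℝ :=
  S / (T * ‖coeff f q‖ * q)

/-- The error in `abs_birkhoff_increment_le` at times `n ≤ C T` and for horizontal displacements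
`|h| ≤ displacement f S T q`, in terms of the quantities whose limits `IsResonant` prescribes. -/
def resonanceError (f : UnitAddCircle → ℝ) (S C T : ℝ) (q : ℕ) (Q : ℝ) : ℝ :=
  4 * Real.pi * S * C * (fourierTail f q / ‖coeff f q‖)
    + 2 * Real.pi * S * coeffMoment f 1 * (T * ‖coeff f q‖)⁻¹
    + 8 * Real.pi * S * C * coeffMoment f 2 * ((T / Q) * (T * ‖coeff f q‖)⁻¹)
    + 8 * Real.pi ^ 2 * S * C ^ 2 * (T / Q)
    + 8 * Real.pi ^ 2 * S ^ 2 * C * (T * ‖coeff f q‖)⁻¹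

theorem IsResonant.tendsto_inv_amplitude (hr : IsResonant α f t q Q) :
    Tendsto (fun j => (t j * ‖coeff f (q j)‖)⁻¹) atTop (𝓝 0) :=
  tendsto_inv_atTop_zero.comp hr.tendsto_amplitude

theorem IsResonant.tendsto_resonanceError (hr : IsResonant α f t q Q) (S C : ℝ) :
    Tendsto (fun j => resonanceError f S C (t j) (q j) (Q j)) atTop (𝓝 0) := by
  have hu := hr.tendsto_inv_amplitude
  have hlim := ((((hr.tendsto_tail.const_mul (4 * Real.pi * S * C)).add
    (hu.const_mul (2 * Real.pi * S * coeffMoment f 1))).add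
    ((hr.tendsto_ratio.mul hu).const_mul (8 * Real.pi * S * C * coeffMoment f 2))).add
    (hr.tendsto_ratio.const_mul (8 * Real.pi ^ 2 * S * C ^ 2))).add
    (hu.const_mul (8 * Real.pi ^ 2 * S ^ 2 * C))
  simpa only [resonanceError, mul_zero, add_zero] using hlim

theorem natCast_mul_displacement (f : UnitAddCircle → ℝ) (S T : ℝ) {q : ℕ} (hq : 0 < q) :
    q * displacement f S T q = S * (T * ‖coeff f q‖)⁻¹ := by
  rw [displacement]
  field_simp

theorem natCast_mul_abs_le {q : ℕ} (hq : 0 < q) {S T h : ℝ} (hh : |h| ≤ displacement f S T q) :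
    q * |h| ≤ S * (T * ‖coeff f q‖)⁻¹ :=
  (mul_le_mul_of_nonneg_left hh q.cast_nonneg).trans_eq (natCast_mul_displacement f S T hq)

theorem IsResonant.tendsto_displacement (hr : IsResonant α f t q Q) (S : ℝ) :
    Tendsto (fun j => displacement f S (t j) (q j)) atTop (𝓝 0) := by
  have hlim := (hr.tendsto_inv_amplitude.const_mul S).norm
  rw [mul_zero, norm_zero] at hlim
  refine squeeze_zero_norm (fun j => ?_) hlim
  rw [← natCast_mul_displacement f S (t j) (hr.freq_pos j), norm_mul, Real.norm_natCast]
  exact le_mul_of_one_le_left (norm_nonneg _) (Nat.one_le_cast.mpr (hr.freq_pos j))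

theorem increment_error_le_resonanceError {q : ℕ} (hq : 0 < q) {Q T C S h : ℝ} (hQ : 0 < Q)
    (hT : 0 < T) (hcoeff : coeff f q ≠ 0) {n : ℕ} (hn : n ≤ C * T)
    (hh : |h| ≤ displacement f S T q) :
    2 * Real.pi * |h| * offResonantBound f Q q n
        + 2 * (‖coeff f q‖ * (n ^ 2 * (2 * Real.pi / Q) * (2 * Real.pi * (q * |h|))
        + n * (2 * Real.pi * (q * |h|)) ^ 2))
      ≤ resonanceError f S C T q Q := by
  set a := ‖coeff f q‖ with ha
  have ha_pos : 0 < a := norm_pos_iff.mpr hcoeff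
  have hqh : q * |h| ≤ S * (T * a)⁻¹ := natCast_mul_abs_le hq hh
  have hh' : |h| ≤ S * (T * a)⁻¹ :=
    (le_mul_of_one_le_left (abs_nonneg h) (Nat.one_le_cast.mpr hq)).trans hqh
  have hCT : 0 ≤ C * T := n.cast_nonneg.trans hn
  have htail := fourierTail_nonneg f q
  have hA := coeffMoment_nonneg f 1
  have hB := coeffMoment_nonneg f 2
  calc _ = 2 * Real.pi * (n * (2 * fourierTail f q) * |h| + coeffMoment f 1 * (q * |h|)
          + n * (4 / Q) * coeffMoment f 2 * |h|)
        + 2 * (a * (n ^ 2 * (2 * Real.pi / Q) * (2 * Real.pi * (q * |h|))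
          + n * (2 * Real.pi * (q * |h|)) ^ 2)) := by rw [offResonantBound]; ring
    _ ≤ 2 * Real.pi * (C * T * (2 * fourierTail f q) * (S * (T * a)⁻¹)
          + coeffMoment f 1 * (S * (T * a)⁻¹)
          + C * T * (4 / Q) * coeffMoment f 2 * (S * (T * a)⁻¹))
        + 2 * (a * ((C * T) ^ 2 * (2 * Real.pi / Q) * (2 * Real.pi * (S * (T * a)⁻¹))
          + C * T * (2 * Real.pi * (S * (T * a)⁻¹)) ^ 2)) := by gcongr
    _ = resonanceError f S C T q Q := by rw [resonanceError, ← ha]; field_simp; ring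

theorem IsResonant.eventually_abs_increment_le (hr : IsResonant α f t q Q) (hf : Continuous f)
    (hsum : Summable fun k : ℤ => ‖coeff f k‖ * |(k : ℝ)| ^ 2) (S C : ℝ) {ε : ℝ} (hε : 0 < ε) :
    ∀ᶠ j in atTop, ∀ n : ℕ, n ≤ C * t j → ∀ (x : UnitAddCircle) (h : ℝ),
      |h| ≤ displacement f S (t j) (q j) →
      |birkhoff α f n (x + h) - birkhoff α f n x
        + 4 * Real.pi * q j * h * n * (coeff f (q j) * fourier (q j : ℤ) x).im| ≤ ε := by
  have hsmall : Tendsto (fun j => 2 * Real.pi * (S * (t j * ‖coeff f (q j)‖)⁻¹)) atTop (𝓝 0) := by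
    simpa only [mul_zero] using (hr.tendsto_inv_amplitude.const_mul S).const_mul (2 * Real.pi)
  filter_upwards [(hr.tendsto_resonanceError S C).eventually_le_const hε,
    hsmall.eventually_le_const zero_lt_one] with j herror hsmall n hn x h hh
  have hqh : 2 * Real.pi * (q j * |h|) ≤ 1 :=
    (mul_le_mul_of_nonneg_left (natCast_mul_abs_le (hr.freq_pos j) hh)
      Real.two_pi_pos.le).trans hsmall
  exact (abs_birkhoff_increment_le hf hsum (hr.isReducedApprox j) (hr.freq_pos j) (hr.Q_pos j)
    n hqh x).trans ((increment_error_le_resonanceError (hr.freq_pos j) (hr.Q_pos j)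
      (hr.time_pos j) (hr.coeff_ne_zero j) hn hh).trans herror)

end Resonance

/-! ### Points with a small shear -/

theorem volume_singleton_unitAddCircle (x : UnitAddCircle) : volume {x} = 0 := by
  rw [← Metric.closedBall_zero, AddCircle.volume_closedBall]
  simp

theorem volume_im_fourier_one_eq_zero :
    volume {y : UnitAddCircle | (fourier 1 y : ℂ).im = 0} = 0 := by
  have : NullSingletonClass (volume : Measure UnitAddCircle) := ⟨volume_singleton_unitAddCircle⟩
  have hinj : Function.Injective fun y : UnitAddCircle => (fourier 1 y : ℂ) := fun y z h => by
    simp only [fourier_apply, one_zsmul] at h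
    exact AddCircle.injective_toCircle one_ne_zero (Subtype.ext h)
  refine (((Set.toFinite {(1 : ℂ), -1}).preimage hinj.injOn).subset fun y hy => ?_).measure_zero _
  have hreal : (fourier 1 y : ℂ) = ((fourier 1 y : ℂ).re : ℂ) :=
    Complex.ext rfl (hy.trans (Complex.ofReal_im _).symm)
  have hnorm := norm_fourier_apply 1 y
  rw [hreal, Complex.norm_real, Real.norm_eq_abs] at hnorm
  rw [Set.mem_preimage, hreal]
  rcases eq_or_eq_neg_of_abs_eq hnorm with h | h <;> rw [h] <;> simp

theorem exists_volume_im_fourier_one_lt {ε : ℝ} (hε : 0 < ε) :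
    ∃ δ > 0, volume.real {y : UnitAddCircle | |(fourier 1 y : ℂ).im| < δ} ≤ ε := by
  set B : ℕ → Set UnitAddCircle := fun n => {y | |(fourier 1 y : ℂ).im| < 1 / ((n : ℝ) + 1)}
    with hB
  have hmeas : ∀ n, MeasurableSet (B n) := fun n =>
    (isOpen_lt (by fun_prop) continuous_const).measurableSet
  have hanti : Antitone B := fun _ _ hnm =>
    Set.ofPred_subset_ofPred.mpr fun _ hy => hy.trans_le (Nat.one_div_le_one_div hnm)
  have hinter : ⋂ n, B n = {y | (fourier 1 y : ℂ).im = 0} := by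
    ext y
    simp only [hB, Set.mem_iInter, Set.mem_ofPred_eq]
    refine ⟨fun h => ?_, fun h n => by rw [h, abs_zero]; positivity⟩
    by_contra hne
    obtain ⟨n, hn⟩ := exists_nat_one_div_lt (abs_pos.mpr hne)
    exact lt_asymm hn (h n)
  have hlim := tendsto_measure_iInter_atTop (μ := volume)
    (fun n => (hmeas n).nullMeasurableSet) hanti ⟨0, measure_ne_top _ _⟩
  rw [hinter, volume_im_fourier_one_eq_zero] at hlim
  obtain ⟨n, hn⟩ :=
    (ENNReal.tendsto_nhds_zero.mp hlim (ENNReal.ofReal ε) (ENNReal.ofReal_pos.mpr hε)).exists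
  exact ⟨1 / ((n : ℝ) + 1), by positivity, ENNReal.toReal_le_of_le_ofReal hε.le hn⟩

theorem measurePreserving_nsmul_add {q : ℕ} (hq : 0 < q) (θ : UnitAddCircle) :
    MeasurePreserving (fun y : UnitAddCircle => q • y + θ) volume volume := by
  rcases (Nat.one_le_iff_ne_zero.mpr hq.ne').eq_or_lt with rfl | h
  · simpa only [one_nsmul] using measurePreserving_add_right volume θ
  · exact (AddCircle.ergodic_nsmul_add θ h).toMeasurePreserving

/-- The sine of the argument of the `q`-th harmonic `a_q e_q(x)` of `f`, i.e. the speed of the shear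
at `x`. -/
def harmonicSine (f : UnitAddCircle → ℝ) (q : ℕ) (x : UnitAddCircle) : ℝ :=
  ((‖coeff f q‖⁻¹ : ℂ) * coeff f q * fourier (q : ℤ) x).im

section HarmonicSine

variable (f : UnitAddCircle → ℝ) (q : ℕ)

theorem im_coeff_mul_fourier (x : UnitAddCircle) :
    (coeff f q * fourier (q : ℤ) x).im = ‖coeff f q‖ * harmonicSine f q x := by
  rw [harmonicSine, ← Complex.im_ofReal_mul]
  rcases eq_or_ne (coeff f q) 0 with h | h
  · simp [h]
  · congr 1
    field_simp [Complex.ofReal_ne_zero.mpr (norm_ne_zero_iff.mpr h)]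

theorem abs_harmonicSine_le_one (x : UnitAddCircle) : |harmonicSine f q x| ≤ 1 := by
  refine (Complex.abs_im_le_norm _).trans ?_
  rw [norm_mul, norm_mul, norm_fourier_apply, norm_inv, Complex.norm_real, norm_norm, mul_one]
  exact inv_mul_le_one

theorem continuous_harmonicSine : Continuous (harmonicSine f q) := by
  unfold harmonicSine
  fun_prop

variable {q}

theorem volume_abs_harmonicSine_lt (hq : 0 < q) (hcoeff : coeff f q ≠ 0) (δ : ℝ) :
    volume.real {x | |harmonicSine f q x| < δ}
      = volume.real {y : UnitAddCircle | |(fourier 1 y : ℂ).im| < δ} := by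
  set c : ℂ := (‖coeff f q‖⁻¹ : ℂ) * coeff f q with hc_def
  have hc : ‖c‖ = 1 := by
    rw [norm_mul, norm_inv, Complex.norm_real, norm_norm,
      inv_mul_cancel₀ (norm_ne_zero_iff.mpr hcoeff)]
  obtain ⟨θ, hθ⟩ := (AddCircle.homeomorphCircle (one_ne_zero (α := ℝ))).surjective
    ⟨c, mem_sphere_zero_iff_norm.mpr hc⟩
  have hθc : (AddCircle.toCircle θ : ℂ) = c := by
    rw [← AddCircle.homeomorphCircle_apply one_ne_zero, hθ]
  have hmeas : MeasurableSet {y : UnitAddCircle | |(fourier 1 y : ℂ).im| < δ} :=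
    (isOpen_lt (by fun_prop) continuous_const).measurableSet
  have hrotate : ∀ x, harmonicSine f q x = (fourier 1 (q • x + θ) : ℂ).im := fun x => by
    rw [harmonicSine, ← hc_def, fourier_apply_add, fourier_apply (x := θ), one_zsmul, hθc, mul_comm]
    simp only [fourier_apply, one_zsmul, natCast_zsmul]
  rw [← (measurePreserving_nsmul_add hq θ).measureReal_preimage hmeas.nullMeasurableSet]
  simp only [hrotate, Set.preimage_ofPred_eq]

end HarmonicSine

/-! ### The shear at resonant times -/

theorem norm_inv_mul_sub_le {z c : ℂ} {ε C L : ℝ} (hL : 0 < L)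
    (h : ‖z - L * c‖ ≤ ε * L + C) : ‖(L⁻¹ : ℂ) * z - c‖ ≤ ε + C / L := by
  have hL' : (L : ℂ) ≠ 0 := Complex.ofReal_ne_zero.mpr hL.ne'
  have hfactor : (L⁻¹ : ℂ) * z - c = (L⁻¹ : ℂ) * (z - L * c) := by field_simp
  rw [hfactor, norm_mul, norm_inv, Complex.norm_of_nonneg hL.le, inv_mul_le_iff₀ hL]
  exact h.trans_eq (by field_simp)

theorem norm_integral_comp_add_mul_sub_le {g : ℝ → ℂ} {c : ℂ} {ε C : ℝ}
    (hg : ∀ v L, 0 ≤ L → ‖(∫ u in v..(v + L), g u) - L * c‖ ≤ ε * L + C) (v : ℝ) {w : ℝ}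
    (hw : w ≠ 0) : ‖(∫ s in (0 : ℝ)..1, g (v + w * s)) - c‖ ≤ ε + C / |w| := by
  rw [intervalIntegral.integral_comp_add_mul _ hw, mul_zero, add_zero, mul_one,
    Complex.real_smul, Complex.ofReal_inv]
  rcases lt_or_gt_of_ne hw with h | h
  · have hneg := norm_inv_mul_sub_le (neg_pos.mpr h) (hg (v + w) (-w) (neg_pos.mpr h).le)
    rw [add_neg_cancel_right] at hneg
    rwa [intervalIntegral.integral_symm, abs_of_neg h, mul_neg, ← neg_mul, ← inv_neg,
      ← Complex.ofReal_neg]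
  · rw [abs_of_pos h]
    exact norm_inv_mul_sub_le h (hg v w h.le)

section Shear

variable {α : ℝ} {f : UnitAddCircle → ℝ} {φ ψ : UnitAddCircle × ℝ → ℂ}
  {t : ℕ → ℝ} {q : ℕ → ℕ} {Q : ℕ → ℝ}

theorem IsTestFunction.exists_norm_integral_comp_mul_sub_le (hφ : IsTestFunction f φ)
    (hα : Irrational α) (hf : Continuous f) (hpos : ∀ x, 0 < f x) (hint : ∫ x, f x = 1) {ε : ℝ}
    (hε : 0 < ε) :
    ∃ L > 0, ∀ (x : UnitAddCircle) (v w : ℝ), L ≤ |w| →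
      ‖(∫ s in (0 : ℝ)..1, orbitLift α f φ (x, v + w * s)) - ∫ p, φ p ∂flowMeasure f‖ ≤ ε := by
  obtain ⟨C, hC⟩ := hφ.exists_norm_integral_sub_le hα hf hpos hint (half_pos hε)
  have hC_nonneg : 0 ≤ C := by simpa using (norm_nonneg _).trans (hC 0 0 0 le_rfl)
  refine ⟨C / (ε / 2) + 1, by positivity, fun x v w hw => ?_⟩
  have hw_pos : 0 < |w| := lt_of_lt_of_le (by positivity) hw
  have hCw : C / |w| ≤ ε / 2 := (div_le_comm₀ hw_pos (half_pos hε)).mpr (by linarith)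
  exact (norm_integral_comp_add_mul_sub_le (hC x) v (abs_pos.mp hw_pos)).trans (by linarith)

theorem IsTestFunction.exists_norm_orbitLift_sub_lt (hφ : IsTestFunction f φ)
    (hf : Continuous f) (hpos : ∀ x, 0 < f x) (K : ℝ) {ε : ℝ} (hε : 0 < ε) :
    ∃ δ > 0, ∀ (x y : UnitAddCircle) (u v : ℝ), |u| ≤ K → |v| ≤ K → ‖x - y‖ < δ → |u - v| < δ →
      ‖orbitLift α f φ (x, u) - orbitLift α f φ (y, v)‖ < ε := by
  have hcompact : IsCompact (Set.univ ×ˢ Set.Icc (-K) K : Set (UnitAddCircle × ℝ)) :=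
    isCompact_univ.prod isCompact_Icc
  obtain ⟨δ, hδ, h⟩ := Metric.uniformContinuousOn_iff.mp (hcompact.uniformContinuousOn_of_continuous
    (hφ.continuous_orbitLift α hf hpos).continuousOn) ε hε
  refine ⟨δ, hδ, fun x y u v hu hv hxy huv => ?_⟩
  rw [← dist_eq_norm]
  refine h (x, u) ⟨Set.mem_univ _, abs_le.mp hu⟩ (y, v) ⟨Set.mem_univ _, abs_le.mp hv⟩ ?_
  rw [Prod.dist_eq, dist_eq_norm, Real.dist_eq]
  exact max_lt hxy huv

theorem IsTestFunction.exists_norm_sub_lt (hψ : IsTestFunction f ψ) (hf : Continuous f)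
    {ε : ℝ} (hε : 0 < ε) : ∃ δ > 0, ∀ (x y : UnitAddCircle) (r : ℝ), ‖x - y‖ < δ →
      ‖ψ (x, r) - ψ (y, r)‖ < ε := by
  obtain ⟨δ, hδ, h⟩ := Metric.uniformContinuous_iff.mp
    ((hψ.hasCompactSupport hf).uniformContinuous_of_continuous hψ.continuous) ε hε
  refine ⟨δ, hδ, fun x y r hxy => ?_⟩
  rw [← dist_eq_norm]
  refine h ?_
  rw [Prod.dist_eq, dist_self, dist_eq_norm]
  exact max_lt hxy hδ

theorem exists_crossings_bounds (α : ℝ) (hf : Continuous f) (hpos : ∀ x, 0 < f x) {m M : ℝ}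
    (hm : 0 < m) (hM : 0 < M) (hmM : ∀ x, m ≤ f x ∧ f x ≤ M) {T r : ℝ} (hT : 2 * M ≤ T)
    (hr : r ∈ Set.Icc 0 M) (x : UnitAddCircle) :
    ∃ n : ℕ, n ≤ 2 / m * T ∧ T / (2 * M) ≤ n ∧ |r + T - birkhoff α f n x| ≤ M := by
  obtain ⟨n, hn⟩ := Int.eq_ofNat_of_zero_le
    (crossings_nonneg α hf hpos x (s := r + T) (by linarith [hr.1]))
  obtain ⟨hlow, hhigh⟩ := crossings_spec α hf hpos x (r + T)
  rw [hn] at hlow hhigh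
  have hlower := natCast_mul_le_birkhoff α (fun x => (hmM x).1) n x
  have hupper := birkhoff_le_natCast_mul α (fun x => (hmM x).2) (n + 1) x
  push_cast at hupper
  refine ⟨n, ?_, ?_, ?_⟩
  · rw [div_mul_eq_mul_div, le_div_iff₀ hm]
    linarith [hr.2]
  · rw [div_le_iff₀ (by positivity)]
    linarith [hr.1]
  · rw [birkhoff_add_one] at hhigh
    rw [abs_of_nonneg (sub_nonneg.mpr hlow)]
    linarith [(hmM (x + (n : ℤ) • (α : UnitAddCircle))).2]

/-- A horizontal displacement by `s` times `displacement f S T q`, at a point with `n` crossings up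
to time `T`, has almost the effect of moving along the flow for the time `s * shearSpeed`. -/
def shearSpeed (f : UnitAddCircle → ℝ) (S T : ℝ) (q n : ℕ) (x : UnitAddCircle) : ℝ :=
  4 * Real.pi * S * (n / T) * harmonicSine f q x

theorem shearSpeed_mul_eq (S : ℝ) {T : ℝ} (hT : T ≠ 0) {q : ℕ} (hq : 0 < q)
    (hcoeff : coeff f q ≠ 0) (n : ℕ) (x : UnitAddCircle) (s : ℝ) :
    4 * Real.pi * q * (displacement f S T q * s) * n * (coeff f q * fourier (q : ℤ) x).im
      = shearSpeed f S T q n x * s := by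
  have ha : ‖coeff f q‖ ≠ 0 := norm_ne_zero_iff.mpr hcoeff
  rw [im_coeff_mul_fourier, shearSpeed, displacement]
  field_simp

theorem abs_displacement_mul_le {S T s : ℝ} (hS : 0 ≤ S) (hT : 0 ≤ T) (q : ℕ)
    (hs : s ∈ Set.Icc (0 : ℝ) 1) : |displacement f S T q * s| ≤ displacement f S T q := by
  have hnonneg : 0 ≤ displacement f S T q := by unfold displacement; positivity
  rw [abs_of_nonneg (mul_nonneg hnonneg hs.1)]
  exact mul_le_of_le_one_right hnonneg hs.2

theorem abs_shearSpeed {S T : ℝ} (hS : 0 ≤ S) (hT : 0 ≤ T) (q n : ℕ) (x : UnitAddCircle) :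
    |shearSpeed f S T q n x| = 4 * Real.pi * S * (n / T) * |harmonicSine f q x| := by
  rw [shearSpeed, abs_mul, abs_of_nonneg (by positivity)]

theorem IsResonant.eventually_abs_increment_add_shear_le (hr : IsResonant α f t q Q)
    (hf : Continuous f) (hsum : Summable fun k : ℤ => ‖coeff f k‖ * |(k : ℝ)| ^ 2) {S : ℝ}
    (hS : 0 ≤ S) (C : ℝ) {ε : ℝ} (hε : 0 < ε) :
    ∀ᶠ j in atTop, ∀ n : ℕ, n ≤ C * t j → ∀ (x : UnitAddCircle), ∀ s ∈ Set.Icc (0 : ℝ) 1,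
      |birkhoff α f n (x + (displacement f S (t j) (q j) * s : ℝ)) - birkhoff α f n x
        + shearSpeed f S (t j) (q j) n x * s| ≤ ε := by
  filter_upwards [hr.eventually_abs_increment_le hf hsum S C hε] with j hj n hn x s hs
  rw [← shearSpeed_mul_eq S (hr.time_pos j).ne' (hr.freq_pos j) (hr.coeff_ne_zero j)]
  exact hj n hn x _ (abs_displacement_mul_le hS (hr.time_pos j).le _ hs)

theorem IsResonant.eventually_norm_orbitLift_sub_le (hr : IsResonant α f t q Q)
    (hf : Continuous f) (hpos : ∀ x, 0 < f x)
    (hsum : Summable fun k : ℤ => ‖coeff f k‖ * |(k : ℝ)| ^ 2) (hφ : IsTestFunction f φ) {M : ℝ}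
    (hM : 0 < M) (hfM : ∀ x, f x ≤ M) {S ε : ℝ} (hS : 0 ≤ S) (hε : 0 < ε) :
    ∀ᶠ j in atTop, ∀ x, ∀ r ∈ Set.Icc 0 M, ∃ w : ℝ,
      2 * Real.pi * S / M * |harmonicSine f (q j) x| ≤ |w| ∧
      ∀ s ∈ Set.Icc (0 : ℝ) 1,
        ‖orbitLift α f φ (x + (displacement f S (t j) (q j) * s : ℝ), r + t j)
          - orbitLift α f φ (x, r + t j + w * s)‖ ≤ ε := by
  obtain ⟨m, M', hm, hmM'⟩ := exists_roof_bounds hf hpos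
  have hmM : ∀ x, m ≤ f x ∧ f x ≤ M := fun x => ⟨(hmM' x).1, hfM x⟩
  set W : ℝ := 4 * Real.pi * S * (2 / m) with hW
  obtain ⟨δ, hδ, hclose⟩ := hφ.exists_norm_orbitLift_sub_lt (α := α) hf hpos (M + W + 1) hε
  filter_upwards [hr.eventually_abs_increment_add_shear_le hf hsum hS (2 / m)
      (ε := min 1 (δ / 2)) (by positivity), hr.tendsto_time.eventually_ge_atTop (2 * M),
    (hr.tendsto_displacement S).eventually_lt_const hδ] with j hshear htime hsmall x r hrM
  have hT := hr.time_pos j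
  obtain ⟨n, hn_le, hle_n, hv⟩ := exists_crossings_bounds α hf hpos hm hM hmM htime hrM x
  set w := shearSpeed f S (t j) (q j) n x with hw
  have hnT_le : n / t j ≤ 2 / m := (div_le_iff₀ hT).mpr hn_le
  have hle_nT : 1 / (2 * M) ≤ n / t j := by
    rw [le_div_iff₀ hT, one_div_mul_eq_div]; exact hle_n
  have hwW : |w| ≤ W := by
    rw [hw, abs_shearSpeed hS hT.le, hW]
    exact (mul_le_of_le_one_right (by positivity) (abs_harmonicSine_le_one f _ x)).trans
      (by gcongr)
  refine ⟨w, ?_, fun s hs => ?_⟩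
  · rw [hw, abs_shearSpeed hS hT.le]
    calc _ = 4 * Real.pi * S * (1 / (2 * M)) * |harmonicSine f (q j) x| := by field_simp; ring
      _ ≤ _ := by gcongr
  · set h := displacement f S (t j) (q j) * s
    have hh : ‖(h : UnitAddCircle)‖ < δ := (QuotientAddGroup.norm_mk_le_norm (m := h)).trans_lt
      ((abs_displacement_mul_le hS hT.le _ hs).trans_lt hsmall)
    have hshear_s := hshear n hn_le x s hs
    have hws : |w * s| ≤ W := by
      rw [abs_mul, abs_of_nonneg hs.1]
      exact (mul_le_of_le_one_right (abs_nonneg w) hs.2).trans hwW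
    -- Both points are followed for `n` crossings, down to the compact part of `𝕋 × ℝ`.
    rw [← orbitLift_sub_birkhoff α hf hpos φ n (x + h), ← orbitLift_sub_birkhoff α hf hpos φ n x]
    rw [le_min_iff, abs_le, abs_le] at hshear_s
    rw [abs_le] at hv hws
    refine (hclose _ _ _ _ (abs_le.mpr ?_) (abs_le.mpr ?_) ?_ (abs_lt.mpr ?_)).le
    · constructor <;> linarith
    · constructor <;> linarith
    · rwa [add_right_comm, add_sub_cancel_left]
    · constructor <;> linarith

theorem norm_intervalIntegral_mul_sub_le {a a' b : ℝ → ℂ} {b₀ c : ℂ} {K₁ K₂ ε ε' : ℝ}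
    (ha : Continuous a) (ha' : Continuous a') (hb : Continuous b) (hK₁ : ∀ s, ‖a s‖ ≤ K₁)
    (hK₂ : ‖b₀‖ ≤ K₂) (haa' : ∀ s ∈ Set.Icc (0 : ℝ) 1, ‖a s - a' s‖ ≤ ε)
    (hbb : ∀ s ∈ Set.Icc (0 : ℝ) 1, ‖b s - b₀‖ ≤ ε) (hc : ‖(∫ s in (0 : ℝ)..1, a' s) - c‖ ≤ ε') :
    ‖(∫ s in (0 : ℝ)..1, a s * b s) - c * b₀‖ ≤ (K₁ + K₂) * ε + ε' * K₂ := by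
  have hpointwise : ∀ s ∈ Set.Icc (0 : ℝ) 1, ‖a s * b s - a' s * b₀‖ ≤ (K₁ + K₂) * ε := by
    intro s hs
    have hε : 0 ≤ ε := (norm_nonneg _).trans (haa' s hs)
    calc ‖a s * b s - a' s * b₀‖ = ‖a s * (b s - b₀) + (a s - a' s) * b₀‖ := by ring_nf
      _ ≤ ‖a s‖ * ‖b s - b₀‖ + ‖a s - a' s‖ * ‖b₀‖ := by
        rw [← norm_mul, ← norm_mul]; exact norm_add_le _ _
      _ ≤ K₁ * ε + ε * K₂ := by
        gcongr
        exacts [(norm_nonneg _).trans (hK₁ s), hK₁ s, hbb s hs, haa' s hs]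
      _ = (K₁ + K₂) * ε := by ring
  have hdiff : ‖(∫ s in (0 : ℝ)..1, a s * b s) - (∫ s in (0 : ℝ)..1, a' s) * b₀‖
      ≤ (K₁ + K₂) * ε := by
    have hab : Continuous fun s => a s * b s := ha.mul hb
    have hab₀ : Continuous fun s => a' s * b₀ := ha'.mul continuous_const
    rw [← intervalIntegral.integral_mul_const, ← intervalIntegral.integral_sub
      (hab.intervalIntegrable _ _) (hab₀.intervalIntegrable _ _)]
    refine (intervalIntegral.norm_integral_le_of_norm_le_const fun s hs => hpointwise s ?_).trans
      (by rw [sub_zero, abs_one, mul_one])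
    rw [Set.uIoc_of_le zero_le_one] at hs
    exact Set.Ioc_subset_Icc_self hs
  calc _ = ‖((∫ s in (0 : ℝ)..1, a s * b s) - (∫ s in (0 : ℝ)..1, a' s) * b₀)
        + ((∫ s in (0 : ℝ)..1, a' s) - c) * b₀‖ := by ring_nf
    _ ≤ (K₁ + K₂) * ε + ‖(∫ s in (0 : ℝ)..1, a' s) - c‖ * ‖b₀‖ := by
      rw [← norm_mul]; exact (norm_add_le _ _).trans (add_le_add_left hdiff _)
    _ ≤ (K₁ + K₂) * ε + ε' * K₂ := by
      gcongr
      exact (norm_nonneg _).trans hc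

/-- The average, over horizontal displacements of size at most `d`, of the product whose integral
is the correlation of `φ` and `ψ` at the time `T`. -/
def shiftAverage (α : ℝ) (f : UnitAddCircle → ℝ) (φ ψ : UnitAddCircle × ℝ → ℂ) (T d : ℝ)
    (p : UnitAddCircle × ℝ) : ℂ :=
  ∫ s in (0 : ℝ)..1,
    orbitLift α f φ (p.1 + (d * s : ℝ), p.2 + T) * ψ (p.1 + (d * s : ℝ), p.2)

theorem IsResonant.exists_eventually_norm_shiftAverage_sub_le (hr : IsResonant α f t q Q)
    (hα : Irrational α) (hf : Continuous f) (hpos : ∀ x, 0 < f x) (hint : ∫ x, f x = 1)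
    (hsum : Summable fun k : ℤ => ‖coeff f k‖ * |(k : ℝ)| ^ 2) (hφ : IsTestFunction f φ)
    (hψ : IsTestFunction f ψ) {M : ℝ} (hM : 0 < M) (hfM : ∀ x, f x ≤ M) {δ ε : ℝ} (hδ : 0 < δ)
    (hε : 0 < ε) :
    ∃ S, ∀ᶠ j in atTop, ∀ x, δ ≤ |harmonicSine f (q j) x| → ∀ r ∈ Set.Icc 0 M,
      ‖shiftAverage α f φ ψ (t j) (displacement f S (t j) (q j)) (x, r)
        - (∫ p, φ p ∂flowMeasure f) * ψ (x, r)‖ ≤ ε := by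
  obtain ⟨K₁, hK₁⟩ := hφ.exists_norm_le hf
  obtain ⟨K₂, hK₂⟩ := hψ.exists_norm_le hf
  have hK₁_nonneg : 0 ≤ K₁ := (norm_nonneg _).trans (hK₁ 0)
  have hK₂_nonneg : 0 ≤ K₂ := (norm_nonneg _).trans (hK₂ 0)
  obtain ⟨ε₁, hε₁, hε₁_le⟩ : ∃ ε₁ > 0, (K₁ + K₂) * ε₁ + ε₁ * K₂ ≤ ε := by
    refine ⟨ε / (K₁ + 2 * K₂ + 1), by positivity, ?_⟩
    field_simp
    linarith
  obtain ⟨L, hL, haverage⟩ := hφ.exists_norm_integral_comp_mul_sub_le hα hf hpos hint hε₁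
  set S : ℝ := M / (2 * Real.pi * δ) * L with hS
  have hSL : 2 * Real.pi * S / M * δ = L := by rw [hS]; field_simp
  obtain ⟨δ₂, hδ₂, hclose⟩ := hψ.exists_norm_sub_lt hf hε₁
  refine ⟨S, ?_⟩
  filter_upwards [hr.eventually_norm_orbitLift_sub_le hf hpos hsum hφ hM hfM
      (by positivity : 0 ≤ S) hε₁, (hr.tendsto_displacement S).eventually_lt_const hδ₂]
    with j hshear hsmall x hx r hrM
  obtain ⟨w, hw, hshear_w⟩ := hshear x r hrM
  have hLw : L ≤ |w| := hSL ▸ le_trans (by gcongr) hw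
  have hlift := hφ.continuous_orbitLift α hf hpos
  have hshift : Continuous fun s : ℝ =>
      x + ((displacement f S (t j) (q j) * s : ℝ) : UnitAddCircle) :=
    continuous_const.add ((AddCircle.continuous_mk' 1).comp (by fun_prop))
  refine (norm_intervalIntegral_mul_sub_le (a' := fun s => orbitLift α f φ (x, r + t j + w * s))
    (hlift.comp (hshift.prodMk continuous_const))
    (hlift.comp (by fun_prop : Continuous fun s => (x, r + t j + w * s)))
    (hψ.continuous.comp (hshift.prodMk continuous_const)) (fun s => hK₁ _) (hK₂ _) hshear_w
    (fun s hs => (hclose _ _ r ?_).le) (haverage x _ w hLw)).trans hε₁_le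
  rw [add_sub_cancel_left]
  exact QuotientAddGroup.norm_mk_le_norm.trans_lt
    ((abs_displacement_mul_le (by positivity) (hr.time_pos j).le _ hs).trans_lt hsmall)

end Shear

/-! ### Correlations of test functions -/

theorem norm_integral_le_of_norm_le_off {X E : Type*} [MeasurableSpace X] {μ : Measure X}
    [IsFiniteMeasure μ] [NormedAddCommGroup E] [NormedSpace ℝ E] {g : X → E} {B : Set X}
    (hB : MeasurableSet B) {η D : ℝ} (hη : 0 ≤ η) (hD : ∀ᵐ p ∂μ, p ∈ B → ‖g p‖ ≤ D)
    (hoff : ∀ᵐ p ∂μ, p ∉ B → ‖g p‖ ≤ η) :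
    ‖∫ p, g p ∂μ‖ ≤ η * μ.real Set.univ + D * μ.real B := by
  have hindicator : Integrable (B.indicator fun _ => D) μ := (integrable_const D).indicator hB
  have hbound : ∀ᵐ p ∂μ, ‖g p‖ ≤ η + B.indicator (fun _ => D) p := by
    filter_upwards [hD, hoff] with p hpD hpoff
    by_cases hp : p ∈ B
    · rw [Set.indicator_of_mem hp]
      exact (hpD hp).trans (le_add_of_nonneg_left hη)
    · rw [Set.indicator_of_notMem hp, add_zero]
      exact hpoff hp
  refine (norm_integral_le_of_norm_le ((integrable_const η).add hindicator) hbound).trans_eq ?_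
  simp only [Pi.add_apply]
  rw [integral_add (integrable_const η) hindicator, integral_const,
    integral_indicator_const D hB, smul_eq_mul, smul_eq_mul, mul_comm η, mul_comm D]

/-- The horizontal strip of height `M` in `𝕋 × ℝ`; the support of a test function, and of all its
horizontal translates, lies in such a strip. -/
def strip (M : ℝ) : Set (UnitAddCircle × ℝ) :=
  Set.univ ×ˢ Set.Icc 0 M

theorem measurableSet_strip (M : ℝ) : MeasurableSet (strip M) :=
  MeasurableSet.univ.prod measurableSet_Icc

instance isFiniteMeasure_volume_restrict_strip (M : ℝ) :
    IsFiniteMeasure ((volume : Measure (UnitAddCircle × ℝ)).restrict (strip M)) :=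
  isFiniteMeasure_restrict.mpr (isCompact_univ.prod isCompact_Icc).measure_ne_top

theorem volume_restrict_strip_prod_univ {M : ℝ} (hM : 0 ≤ M) {B : Set UnitAddCircle}
    (hB : MeasurableSet B) :
    ((volume : Measure (UnitAddCircle × ℝ)).restrict (strip M)).real (B ×ˢ Set.univ)
      = volume.real B * M := by
  rw [measureReal_restrict_apply (hB.prod MeasurableSet.univ), strip, Set.prod_inter_prod,
    Set.inter_univ, Set.univ_inter, Measure.volume_eq_prod, measureReal_prod_prod,
    Real.volume_real_Icc_of_le hM, sub_zero]

section Correlation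

variable {α : ℝ} {f : UnitAddCircle → ℝ} {φ ψ : UnitAddCircle × ℝ → ℂ}

theorem IsTestFunction.support_subset_strip (hψ : IsTestFunction f ψ) {M : ℝ}
    (hfM : ∀ x, f x ≤ M) (h : UnitAddCircle) :
    (Function.support fun p : UnitAddCircle × ℝ => ψ (p.1 + h, p.2)) ⊆ strip M := fun p hp =>
  have hmem : (p.1 + h, p.2) ∈ flowSpace f := hψ.support_subset hp
  ⟨Set.mem_univ _, hmem.1, hmem.2.le.trans (hfM _)⟩

theorem IsTestFunction.setIntegral_strip_mul (hψ : IsTestFunction f ψ) {M : ℝ}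
    (hfM : ∀ x, f x ≤ M) (F : UnitAddCircle × ℝ → ℂ) (h : UnitAddCircle) :
    ∫ p in strip M, F p * ψ (p.1 + h, p.2) = ∫ p, F p * ψ (p.1 + h, p.2) :=
  setIntegral_eq_integral_of_forall_compl_eq_zero fun _ hp =>
    mul_eq_zero_of_right _ (Function.notMem_support.mp fun hmem =>
      hp (hψ.support_subset_strip hfM h hmem))

theorem IsTestFunction.setIntegral_strip (hψ : IsTestFunction f ψ) {M : ℝ}
    (hfM : ∀ x, f x ≤ M) : ∫ p in strip M, ψ p = ∫ p, ψ p ∂flowMeasure f := by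
  rw [hψ.integral_flowMeasure]
  simpa only [one_mul, add_zero] using hψ.setIntegral_strip_mul hfM (fun _ => 1) 0

theorem integral_comp_add_fst (g : UnitAddCircle × ℝ → ℂ) (h : UnitAddCircle) :
    ∫ p : UnitAddCircle × ℝ, g (p.1 + h, p.2) = ∫ p, g p := by
  have hinv : (volume : Measure (UnitAddCircle × ℝ)).IsAddRightInvariant :=
    inferInstanceAs
      ((volume : Measure UnitAddCircle).prod (volume : Measure ℝ)).IsAddRightInvariant
  rw [← integral_add_right_eq_self g (h, (0 : ℝ))]
  simp only [Prod.add_def, add_zero]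

theorem orbitLift_add (hf : Continuous f) (hpos : ∀ x, 0 < f x) (φ : UnitAddCircle × ℝ → ℂ)
    (T : ℝ) (p : UnitAddCircle × ℝ) :
    orbitLift α f φ (p.1, p.2 + T) = φ (specialFlow α f T p) := by
  simpa only [skewMap, zero_zsmul, add_zero, birkhoff_zero, sub_zero]
    using orbitLift_skewMap α hf hpos φ 0 T p

theorem IsTestFunction.integral_comp_specialFlow_mul (hψ : IsTestFunction f ψ)
    (hf : Continuous f) (hpos : ∀ x, 0 < f x) {M : ℝ} (hfM : ∀ x, f x ≤ M)
    (φ : UnitAddCircle × ℝ → ℂ) (T : ℝ) (h : UnitAddCircle) :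
    ∫ p in strip M, orbitLift α f φ (p.1 + h, p.2 + T) * ψ (p.1 + h, p.2)
      = ∫ p, φ (specialFlow α f T p) * ψ p ∂flowMeasure f := by
  have hsupport : ∀ p ∉ flowSpace f, φ (specialFlow α f T p) * ψ p = 0 := fun p hp =>
    mul_eq_zero_of_right _ (Function.notMem_support.mp fun hmem => hp (hψ.support_subset hmem))
  rw [hψ.setIntegral_strip_mul hfM (fun p => orbitLift α f φ (p.1 + h, p.2 + T)),
    integral_comp_add_fst (fun p => orbitLift α f φ (p.1, p.2 + T) * ψ p), flowMeasure,
    setIntegral_eq_integral_of_forall_compl_eq_zero hsupport]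
  simp only [orbitLift_add hf hpos]

theorem IsTestFunction.continuous_shiftProduct (hφ : IsTestFunction f φ) (hψ : IsTestFunction f ψ)
    (hf : Continuous f) (hpos : ∀ x, 0 < f x) (T d : ℝ) :
    Continuous fun z : (UnitAddCircle × ℝ) × ℝ =>
      orbitLift α f φ (z.1.1 + (d * z.2 : ℝ), z.1.2 + T) * ψ (z.1.1 + (d * z.2 : ℝ), z.1.2) := by
  have hshift : Continuous fun z : (UnitAddCircle × ℝ) × ℝ =>
      z.1.1 + ((d * z.2 : ℝ) : UnitAddCircle) :=
    continuous_fst.fst.add ((AddCircle.continuous_mk' 1).comp (by fun_prop))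
  exact ((hφ.continuous_orbitLift α hf hpos).comp (hshift.prodMk (by fun_prop))).mul
    (hψ.continuous.comp (hshift.prodMk (by fun_prop)))

theorem IsTestFunction.continuous_shiftAverage (hφ : IsTestFunction f φ)
    (hψ : IsTestFunction f ψ) (hf : Continuous f) (hpos : ∀ x, 0 < f x) (T d : ℝ) :
    Continuous (shiftAverage α f φ ψ T d) :=
  intervalIntegral.continuous_parametric_intervalIntegral_of_continuous'
    (hφ.continuous_shiftProduct hψ hf hpos T d) 0 1

theorem norm_shiftAverage_le {K₁ K₂ : ℝ} (hK₁ : ∀ p, ‖φ p‖ ≤ K₁) (hK₂ : ∀ p, ‖ψ p‖ ≤ K₂)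
    (T d : ℝ) (p : UnitAddCircle × ℝ) : ‖shiftAverage α f φ ψ T d p‖ ≤ K₁ * K₂ :=
  (intervalIntegral.norm_integral_le_of_norm_le_const fun _ _ =>
    norm_mul_le_of_le (hK₁ _) (hK₂ _)).trans (by rw [sub_zero, abs_one, mul_one])

theorem IsTestFunction.setIntegral_shiftAverage (hφ : IsTestFunction f φ)
    (hψ : IsTestFunction f ψ) (hf : Continuous f) (hpos : ∀ x, 0 < f x) {M : ℝ}
    (hfM : ∀ x, f x ≤ M) (T d : ℝ) :
    ∫ p in strip M, shiftAverage α f φ ψ T d p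
      = ∫ p, φ (specialFlow α f T p) * ψ p ∂flowMeasure f := by
  obtain ⟨K₁, hK₁⟩ := hφ.exists_norm_le hf
  obtain ⟨K₂, hK₂⟩ := hψ.exists_norm_le hf
  have hfinite : IsFiniteMeasure ((volume : Measure ℝ).restrict (Set.uIoc 0 1)) :=
    isFiniteMeasure_restrict.mpr
      (by rw [Set.uIoc_of_le zero_le_one]; exact measure_Ioc_lt_top.ne)
  have hintegrable : Integrable (Function.uncurry fun (s : ℝ) (p : UnitAddCircle × ℝ) =>
      orbitLift α f φ (p.1 + (d * s : ℝ), p.2 + T) * ψ (p.1 + (d * s : ℝ), p.2))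
      ((volume.restrict (Set.uIoc 0 1)).prod (volume.restrict (strip M))) :=
    .of_bound ((hφ.continuous_shiftProduct hψ hf hpos T d).comp
      continuous_swap).aestronglyMeasurable (K₁ * K₂)
      (.of_forall fun _ => norm_mul_le_of_le (hK₁ _) (hK₂ _))
  simp only [shiftAverage]
  rw [← intervalIntegral_integral_swap hintegrable]
  simp only [hψ.integral_comp_specialFlow_mul hf hpos hfM φ T]
  rw [intervalIntegral.integral_const, sub_zero, one_smul]

theorem IsTestFunction.norm_correlation_sub_le (hφ : IsTestFunction f φ)
    (hψ : IsTestFunction f ψ) (hf : Continuous f) (hpos : ∀ x, 0 < f x) {M : ℝ} (hM : 0 ≤ M)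
    (hfM : ∀ x, f x ≤ M) {K₁ K₂ : ℝ} (hK₁ : ∀ p, ‖φ p‖ ≤ K₁) (hK₂ : ∀ p, ‖ψ p‖ ≤ K₂) (T d : ℝ)
    (c : ℂ) {B : Set UnitAddCircle} (hB : MeasurableSet B) {η : ℝ} (hη : 0 ≤ η)
    (hoff : ∀ x ∉ B, ∀ r ∈ Set.Icc 0 M, ‖shiftAverage α f φ ψ T d (x, r) - c * ψ (x, r)‖ ≤ η) :
    ‖(∫ p, φ (specialFlow α f T p) * ψ p ∂flowMeasure f) - c * ∫ p, ψ p ∂flowMeasure f‖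
      ≤ η * M + (K₁ * K₂ + ‖c‖ * K₂) * (volume.real B * M) := by
  have havg_bound := norm_shiftAverage_le (α := α) (f := f) hK₁ hK₂ T d
  have hint_avg : Integrable (shiftAverage α f φ ψ T d) (volume.restrict (strip M)) :=
    .of_bound (hφ.continuous_shiftAverage hψ hf hpos T d).aestronglyMeasurable (K₁ * K₂)
      (.of_forall havg_bound)
  have hint_ψ : Integrable ψ (volume.restrict (strip M)) :=
    .of_bound hψ.continuous.aestronglyMeasurable K₂ (.of_forall hK₂)
  have hbound : ∀ p, ‖shiftAverage α f φ ψ T d p - c * ψ p‖ ≤ K₁ * K₂ + ‖c‖ * K₂ := fun p =>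
    norm_sub_le_of_le (havg_bound p) (norm_mul_le_of_le le_rfl (hK₂ p))
  have hmain := norm_integral_le_of_norm_le_off (μ := volume.restrict (strip M))
    (g := fun p => shiftAverage α f φ ψ T d p - c * ψ p) (hB.prod MeasurableSet.univ) hη
    (.of_forall fun p _ => hbound p)
    ((ae_restrict_iff' (measurableSet_strip M)).mpr (.of_forall fun p hp hpB =>
      hoff p.1 (fun h => hpB ⟨h, Set.mem_univ _⟩) p.2 hp.2))
  rwa [integral_sub hint_avg (hint_ψ.const_mul c), integral_const_mul,
    hφ.setIntegral_shiftAverage hψ hf hpos hfM, hψ.setIntegral_strip hfM,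
    volume_restrict_strip_prod_univ hM hB, ← Set.univ_prod_univ,
    volume_restrict_strip_prod_univ hM MeasurableSet.univ, measureReal_def volume Set.univ,
    UnitAddCircle.measure_univ, ENNReal.toReal_one, one_mul] at hmain

theorem IsResonant.tendsto_correlation {t : ℕ → ℝ} {q : ℕ → ℕ} {Q : ℕ → ℝ}
    (hr : IsResonant α f t q Q) (hα : Irrational α) (hf : Continuous f) (hpos : ∀ x, 0 < f x)
    (hint : ∫ x, f x = 1) (hsum : Summable fun k : ℤ => ‖coeff f k‖ * |(k : ℝ)| ^ 2)
    (hφ : IsTestFunction f φ) (hψ : IsTestFunction f ψ) :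
    Tendsto (fun j => ∫ p, φ (specialFlow α f (t j) p) * ψ p ∂flowMeasure f) atTop
      (𝓝 ((∫ p, φ p ∂flowMeasure f) * ∫ p, ψ p ∂flowMeasure f)) := by
  obtain ⟨_, M, _, hmM⟩ := exists_roof_bounds hf hpos
  have hfM : ∀ x, f x ≤ M := fun x => (hmM x).2
  have hM : 0 < M := (hpos 0).trans_le (hfM 0)
  obtain ⟨K₁, hK₁⟩ := hφ.exists_norm_le hf
  obtain ⟨K₂, hK₂⟩ := hψ.exists_norm_le hf
  have hK₁_nonneg : 0 ≤ K₁ := (norm_nonneg _).trans (hK₁ 0)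
  have hK₂_nonneg : 0 ≤ K₂ := (norm_nonneg _).trans (hK₂ 0)
  set c : ℂ := ∫ p, φ p ∂flowMeasure f
  set D : ℝ := K₁ * K₂ + ‖c‖ * K₂ with hD
  rw [tendsto_iff_norm_sub_tendsto_zero, Metric.tendsto_nhds]
  intro ε hε
  obtain ⟨δ, hδ, hvol⟩ := exists_volume_im_fourier_one_lt
    (ε := ε / (4 * M * (D + 1))) (by positivity)
  obtain ⟨S, havg⟩ := hr.exists_eventually_norm_shiftAverage_sub_le hα hf hpos hint hsum hφ hψ hM
    hfM hδ (ε := ε / (4 * M)) (by positivity)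
  filter_upwards [havg] with j hj
  rw [dist_zero_right, norm_norm]
  refine (hφ.norm_correlation_sub_le hψ hf hpos hM.le hfM hK₁ hK₂ (t j) _ c
    (B := {x | |harmonicSine f (q j) x| < δ})
    (isOpen_lt (continuous_harmonicSine f _).abs continuous_const).measurableSet
    (by positivity) fun x hx => hj x (not_lt.mp hx)).trans_lt ?_
  rw [volume_abs_harmonicSine_lt f (hr.freq_pos j) (hr.coeff_ne_zero j), ← hD]
  calc _ ≤ ε / (4 * M) * M + (D + 1) * (ε / (4 * M * (D + 1)) * M) := by
        gcongr
        linarith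
    _ = ε / 2 := by
        have hD_pos : 0 < D + 1 := by rw [hD]; positivity
        field_simp
        norm_num
    _ < ε := half_lt_self hε

end Correlation

/-! ### Density of test functions in `L²` -/

theorem tendsto_eLpNorm_zero_of_dominated {X E : Type*} [MeasurableSpace X] {μ : Measure X}
    [NormedAddCommGroup E] {p : ENNReal} (hp : p ≠ 0) (hp' : p ≠ ⊤) {F : ℕ → X → E} {g : X → E}
    (hF : ∀ n, AEStronglyMeasurable (F n) μ) (hg : MemLp g p μ)
    (hbound : ∀ n, ∀ᵐ x ∂μ, ‖F n x‖ ≤ ‖g x‖)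
    (hlim : ∀ᵐ x ∂μ, Tendsto (fun n => F n x) atTop (𝓝 0)) :
    Tendsto (fun n => eLpNorm (F n) p μ) atTop (𝓝 0) := by
  have hp_pos : 0 < p.toReal := ENNReal.toReal_pos hp hp'
  have hlintegral : Tendsto (fun n => ∫⁻ x, ‖F n x‖ₑ ^ p.toReal ∂μ) atTop
      (𝓝 (∫⁻ _, 0 ∂μ)) := by
    refine tendsto_lintegral_of_dominated_convergence' (fun x => ‖g x‖ₑ ^ p.toReal)
      (fun n => (hF n).enorm.pow_const _) (fun n => ?_)
      (lintegral_rpow_enorm_lt_top_of_eLpNorm_lt_top hp hp' hg.eLpNorm_lt_top).ne ?_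
    · filter_upwards [hbound n] with x hx
      exact ENNReal.rpow_le_rpow (enorm_le_iff_norm_le.mpr hx) hp_pos.le
    · filter_upwards [hlim] with x hx
      simpa only [enorm_zero, ENNReal.zero_rpow_of_pos hp_pos] using
        hx.enorm.ennrpow_const p.toReal
  simp only [eLpNorm_eq_lintegral_rpow_enorm_toReal hp hp']
  rw [lintegral_zero] at hlintegral
  simpa only [ENNReal.zero_rpow_of_pos (one_div_pos.mpr hp_pos)] using
    hlintegral.ennrpow_const (1 / p.toReal)

section TestFunctionsDense

variable {f : UnitAddCircle → ℝ} {φ : UnitAddCircle × ℝ → ℂ}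

theorem ae_snd_ne_zero : ∀ᵐ p : UnitAddCircle × ℝ, p.2 ≠ 0 := by
  have hset : {p : UnitAddCircle × ℝ | ¬p.2 ≠ 0} = Set.univ ×ˢ {0} := by ext; simp
  rw [ae_iff, hset, Measure.volume_eq_prod, Measure.prod_prod, Real.volume_singleton, mul_zero]

theorem ae_flowMeasure_pos_and_lt (hf : Continuous f) :
    ∀ᵐ p ∂flowMeasure f, 0 < p.2 ∧ p.2 < f p.1 := by
  refine (ae_restrict_iff' (measurableSet_flowSpace hf)).mpr ?_
  filter_upwards [ae_snd_ne_zero] with p hp hmem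
  exact ⟨hmem.1.lt_of_ne' hp, hmem.2⟩

theorem flowSpace_ae_eq_regionBetween :
    flowSpace f =ᵐ[volume] regionBetween (fun _ => 0) f Set.univ := by
  filter_upwards [ae_snd_ne_zero] with p hp
  exact propext ⟨fun h => ⟨Set.mem_univ _, h.1.lt_of_ne' hp, h.2⟩, fun h => ⟨h.2.1.le, h.2.2⟩⟩

theorem isProbabilityMeasure_flowMeasure (hf : Continuous f) (hnonneg : ∀ x, 0 ≤ f x)
    (hint : ∫ x, f x = 1) : IsProbabilityMeasure (flowMeasure f) where
  measure_univ := by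
    have hf_int : IntegrableOn f Set.univ :=
      (hf.integrable_of_hasCompactSupport (.of_compactSpace _)).integrableOn
    rw [flowMeasure, Measure.restrict_apply_univ, measure_congr flowSpace_ae_eq_regionBetween,
      Measure.volume_eq_prod, volume_regionBetween_eq_integral integrableOn_zero hf_int
      MeasurableSet.univ fun x _ => hnonneg x]
    simp [hint]

/-- Continuous functions, equal to `0` off the open region below the roof, that increase to its
indicator function as `k → ∞`; products with them turn continuous functions into test
functions. -/
def cutoff (f : UnitAddCircle → ℝ) (k : ℕ) (p : UnitAddCircle × ℝ) : ℝ :=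
  min 1 (max 0 (k * min p.2 (f p.1 - p.2)))

theorem cutoff_nonneg (f : UnitAddCircle → ℝ) (k : ℕ) (p : UnitAddCircle × ℝ) :
    0 ≤ cutoff f k p :=
  le_min zero_le_one (le_max_left _ _)

theorem cutoff_le_one (f : UnitAddCircle → ℝ) (k : ℕ) (p : UnitAddCircle × ℝ) :
    cutoff f k p ≤ 1 :=
  min_le_left _ _

theorem isTestFunction_cutoff_mul (hf : Continuous f) {g : UnitAddCircle × ℝ → ℂ}
    (hg : Continuous g) (k : ℕ) : IsTestFunction f fun p => (cutoff f k p : ℂ) * g p where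
  continuous := by
    unfold cutoff
    fun_prop
  eq_zero p hp := by
    have hmin : min p.2 (f p.1 - p.2) ≤ 0 := min_le_iff.mpr (hp.imp_right sub_nonpos.mpr)
    rw [cutoff, max_eq_left (mul_nonpos_of_nonneg_of_nonpos k.cast_nonneg hmin),
      min_eq_right zero_le_one, Complex.ofReal_zero, zero_mul]

theorem tendsto_cutoff {p : UnitAddCircle × ℝ} (hp : 0 < p.2 ∧ p.2 < f p.1) :
    Tendsto (fun k => cutoff f k p) atTop (𝓝 1) := by
  have hmin : 0 < min p.2 (f p.1 - p.2) := lt_min hp.1 (sub_pos.mpr hp.2)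
  refine tendsto_const_nhds.congr' ?_
  filter_upwards [tendsto_natCast_atTop_atTop.eventually_ge_atTop
    (min p.2 (f p.1 - p.2))⁻¹] with k hk
  rw [inv_le_iff_one_le_mul₀ hmin] at hk
  rw [cutoff, max_eq_right (zero_le_one.trans hk), min_eq_left hk]

theorem tendsto_eLpNorm_cutoff_mul_sub (hf : Continuous f) {q : ENNReal} (hq : q ≠ 0)
    (hq' : q ≠ ⊤) {g : UnitAddCircle × ℝ → ℂ} (hg : Continuous g)
    (hgq : MemLp g q (flowMeasure f)) :
    Tendsto (fun k => eLpNorm ((fun p => (cutoff f k p : ℂ) * g p) - g) q (flowMeasure f)) atTop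
      (𝓝 0) := by
  have hfactor : ∀ k p, (cutoff f k p : ℂ) * g p - g p = ((cutoff f k p - 1 : ℝ) : ℂ) * g p := by
    intro k p
    push_cast
    ring
  refine tendsto_eLpNorm_zero_of_dominated hq hq' (fun k =>
    ((isTestFunction_cutoff_mul hf hg k).continuous.sub hg).aestronglyMeasurable) hgq
    (fun k => .of_forall fun p => ?_) ?_
  · rw [Pi.sub_apply, hfactor, norm_mul, Complex.norm_real, Real.norm_eq_abs]
    refine mul_le_of_le_one_left (norm_nonneg _) (abs_le.mpr ⟨?_, ?_⟩)
    · linarith [cutoff_nonneg f k p]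
    · linarith [cutoff_le_one f k p]
  · filter_upwards [ae_flowMeasure_pos_and_lt hf] with p hp
    have hlim := (Complex.continuous_ofReal.tendsto _).comp ((tendsto_cutoff hp).sub_const 1)
    simpa only [Function.comp_def, hfactor, Pi.sub_apply, sub_self, Complex.ofReal_zero,
      zero_mul] using hlim.mul_const (g p)

theorem IsTestFunction.memLp (hφ : IsTestFunction f φ) (hf : Continuous f)
    [IsFiniteMeasure (flowMeasure f)] (q : ENNReal) : MemLp φ q (flowMeasure f) :=
  have ⟨K, hK⟩ := hφ.exists_norm_le hf
  .of_bound hφ.continuous.aestronglyMeasurable K (.of_forall hK)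

theorem IsTestFunction.conj (hφ : IsTestFunction f φ) :
    IsTestFunction f fun p => (starRingEnd ℂ) (φ p) where
  continuous := Complex.continuous_conj.comp hφ.continuous
  eq_zero p hp := by rw [hφ.eq_zero p hp, map_zero]

theorem dense_toLp_isTestFunction (hf : Continuous f) [IsFiniteMeasure (flowMeasure f)]
    {q : ENNReal} [Fact (1 ≤ q)] (hq : q ≠ ⊤) :
    Dense {G : Lp ℂ q (flowMeasure f) | ∃ (φ : UnitAddCircle × ℝ → ℂ) (hφ : IsTestFunction f φ),
      G = (hφ.memLp hf q).toLp φ} := by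
  refine dense_closure.mp
    ((BoundedContinuousFunction.toLp_denseRange ℂ (flowMeasure f) ℂ hq).mono ?_)
  rintro _ ⟨g, rfl⟩
  have hg : MemLp g q (flowMeasure f) :=
    .of_bound g.continuous.aestronglyMeasurable ‖g‖ (.of_forall g.norm_coe_le_norm)
  have htest := isTestFunction_cutoff_mul hf g.continuous
  exact mem_closure_of_tendsto ((Lp.tendsto_Lp_iff_tendsto_eLpNorm'' _
    (fun k => (htest k).memLp hf q) _ hg).mpr (tendsto_eLpNorm_cutoff_mul_sub hf
      (zero_lt_one.trans_le Fact.out).ne' hq g.continuous hg)) (.of_forall fun k =>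
      ⟨_, htest k, rfl⟩)

end TestFunctionsDense

/-! ### Mixing from a dense set of observables -/

theorem tendsto_inner_map_of_dense {𝕜 ι H : Type*} [RCLike 𝕜] [NormedAddCommGroup H]
    [InnerProductSpace 𝕜 H] {a : Filter ι} (U : ι → H →ₗᵢ[𝕜] H) {b : H × H → 𝕜}
    (hb : Continuous b) {D : Set H} (hD : Dense D)
    (h : ∀ x ∈ D, ∀ y ∈ D, Tendsto (fun i => inner 𝕜 y (U i x)) a (𝓝 (b (x, y)))) (x y : H) :
    Tendsto (fun i => inner 𝕜 y (U i x)) a (𝓝 (b (x, y))) := by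
  have hmodulus : Tendsto (fun z : H × H => ‖y - z.2‖ * ‖x‖ + ‖z.2‖ * ‖x - z.1‖) (𝓝 (x, y))
      (𝓝 0) := by
    have hcont : Continuous fun z : H × H => ‖y - z.2‖ * ‖x‖ + ‖z.2‖ * ‖x - z.1‖ := by fun_prop
    simpa only [sub_self, norm_zero, zero_mul, mul_zero, add_zero] using hcont.tendsto (x, y)
  have hequi : EquicontinuousAt (fun i (z : H × H) => inner 𝕜 z.2 (U i z.1)) (x, y) := by
    refine Metric.equicontinuousAt_of_continuity_modulus _ hmodulus _ (.of_forall fun z i => ?_)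
    have hsplit : inner 𝕜 y (U i x) - inner 𝕜 z.2 (U i z.1)
        = inner 𝕜 (y - z.2) (U i x) + inner 𝕜 z.2 (U i (x - z.1)) := by
      rw [map_sub, inner_sub_left, inner_sub_right]
      ring
    rw [dist_eq_norm, hsplit]
    refine norm_add_le_of_le ?_ ?_
    · simpa only [LinearIsometry.norm_map] using norm_inner_le_norm (𝕜 := 𝕜) (y - z.2) (U i x)
    · simpa only [LinearIsometry.norm_map] using norm_inner_le_norm (𝕜 := 𝕜) z.2 (U i (x - z.1))
  exact hequi.tendsto_of_mem_closure (s := D ×ˢ D) (hb.continuousWithinAt.tendsto)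
    (fun z hz => h z.1 hz.1 z.2 hz.2) (hD.prod hD (x, y))

theorem inner_toLp_toLp {X 𝕜 : Type*} [RCLike 𝕜] [MeasurableSpace X] {μ : Measure X}
    {g₁ g₂ : X → 𝕜} (h₁ : MemLp g₁ 2 μ) (h₂ : MemLp g₂ 2 μ) :
    inner 𝕜 (h₂.toLp g₂) (h₁.toLp g₁) = ∫ x, g₁ x * (starRingEnd 𝕜) (g₂ x) ∂μ := by
  rw [L2.inner_def]
  refine integral_congr_ae ?_
  filter_upwards [h₁.coeFn_toLp, h₂.coeFn_toLp] with x hx₁ hx₂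
  rw [hx₁, hx₂, RCLike.inner_apply]

theorem tendsto_correlation_of_isTestFunction {α : ℝ} {f : UnitAddCircle → ℝ}
    (hf : Continuous f) (hpos : ∀ x, 0 < f x) [IsFiniteMeasure (flowMeasure f)] {ι : Type*}
    {a : Filter ι} {t : ι → ℝ}
    (h : ∀ φ ψ, IsTestFunction f φ → IsTestFunction f ψ →
      Tendsto (fun j => ∫ p, φ (specialFlow α f (t j) p) * ψ p ∂flowMeasure f) a
        (𝓝 ((∫ p, φ p ∂flowMeasure f) * ∫ p, ψ p ∂flowMeasure f)))
    {g₁ g₂ : UnitAddCircle × ℝ → ℂ} (hg₁ : MemLp g₁ 2 (flowMeasure f))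
    (hg₂ : MemLp g₂ 2 (flowMeasure f)) :
    Tendsto (fun j => ∫ p, g₁ (specialFlow α f (t j) p) * (starRingEnd ℂ) (g₂ p) ∂flowMeasure f)
      a (𝓝 ((∫ p, g₁ p ∂flowMeasure f) * ∫ p, (starRingEnd ℂ) (g₂ p) ∂flowMeasure f)) := by
  have hmp := fun j => measurePreserving_specialFlow α hf hpos (t j)
  have hone : MemLp (fun _ => (1 : ℂ)) 2 (flowMeasure f) := memLp_const 1
  have hinner : ∀ {g₁ g₂ : UnitAddCircle × ℝ → ℂ} (hg₁ : MemLp g₁ 2 (flowMeasure f))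
      (hg₂ : MemLp g₂ 2 (flowMeasure f)) (j : ι), inner ℂ (hg₂.toLp g₂)
        (Lp.compMeasurePreservingₗᵢ ℂ (specialFlow α f (t j)) (hmp j) (hg₁.toLp g₁))
      = ∫ p, g₁ (specialFlow α f (t j) p) * (starRingEnd ℂ) (g₂ p) ∂flowMeasure f :=
    fun hg₁ hg₂ j => inner_toLp_toLp (hg₁.comp_measurePreserving (hmp j)) hg₂
  have hmix := tendsto_inner_map_of_dense (a := a)
    (fun j => Lp.compMeasurePreservingₗᵢ ℂ (specialFlow α f (t j)) (hmp j))
    (b := fun z => inner ℂ (hone.toLp _) z.1 * inner ℂ z.2 (hone.toLp _)) (by fun_prop)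
    (dense_toLp_isTestFunction hf ENNReal.ofNat_ne_top) ?_ (hg₁.toLp g₁) (hg₂.toLp g₂)
  · simpa only [hinner, inner_toLp_toLp, map_one, mul_one, one_mul] using hmix
  · rintro _ ⟨φ, hφ, rfl⟩ _ ⟨ψ, hψ, rfl⟩
    simpa only [hinner, inner_toLp_toLp, map_one, mul_one, one_mul] using h φ _ hφ hψ.conj

/-! ### Rotation numbers with resonant times -/

section RotationNumbers

variable {α β : ℝ} {f : UnitAddCircle → ℝ} {l : ℕ → ℕ}

theorem two_mul_sq_div_lt_convDen_eta (hβ : Irrational β) (f : UnitAddCircle → ℝ) (l : ℕ → ℕ)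
    (k : ℕ) : 2 * (k : ℝ) ^ 2 / ‖coeff f (l k)‖ ^ 2 < convDen β (eta β f l k) := by
  have hne : {n : ℕ | 1 ≤ n ∧ 2 * (k : ℝ) ^ 2 / ‖coeff f (l k)‖ ^ 2 < convDen β n}.Nonempty :=
    ((eventually_ge_atTop 1).and ((tendsto_convDen hβ).eventually_gt_atTop _)).exists
  exact (Nat.sInf_mem hne).2

theorem convDen_eta_pos (hβ : Irrational β) (f : UnitAddCircle → ℝ) (l : ℕ → ℕ) (k : ℕ) :
    0 < convDen β (eta β f l k) :=
  lt_of_le_of_lt (by positivity) (two_mul_sq_div_lt_convDen_eta hβ f l k)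

theorem natCast_le_convDen_eta_mul_norm_coeff (hβ : Irrational β) {k : ℕ}
    (hcoeff : coeff f (l k) ≠ 0) (hle : ‖coeff f (l k)‖ ≤ 1) :
    (k : ℝ) ≤ convDen β (eta β f l k) * ‖coeff f (l k)‖ := by
  have heta := two_mul_sq_div_lt_convDen_eta hβ f l k
  rw [div_lt_iff₀ (pow_pos (norm_pos_iff.mpr hcoeff) 2)] at heta
  have hk : (k : ℝ) ≤ (k : ℝ) ^ 2 := by exact_mod_cast Nat.le_self_pow two_ne_zero k
  have hsq : ‖coeff f (l k)‖ ^ 2 ≤ ‖coeff f (l k)‖ :=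
    pow_le_of_le_one (norm_nonneg _) hle two_ne_zero
  calc (k : ℝ) ≤ 2 * (k : ℝ) ^ 2 := by linarith [sq_nonneg (k : ℝ)]
    _ ≤ convDen β (eta β f l k) * ‖coeff f (l k)‖ ^ 2 := heta.le
    _ ≤ convDen β (eta β f l k) * ‖coeff f (l k)‖ :=
        mul_le_mul_of_nonneg_left hsq (convDen_eta_pos hβ f l k).le

theorem convDen_succ_pos_of_mem_setV (hβ : Irrational β) {i j : ℕ} (hα : α ∈ setV β f l i j) :
    0 < convDen α (i + 1) :=
  have hη := convDen_eta_pos hβ f l j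
  lt_of_le_of_lt (by positivity) hα.2.2

theorem convDen_eta_div_le_inv (hβ : Irrational β) {i j : ℕ} (hi : 1 ≤ i)
    (hα : α ∈ setV β f l i j) :
    convDen β (eta β f l j) / convDen α (i + 1) ≤ (i : ℝ)⁻¹ := by
  have hη := convDen_eta_pos hβ f l j
  have hi' : (1 : ℝ) ≤ i := by exact_mod_cast hi
  rw [div_le_iff₀ (convDen_succ_pos_of_mem_setV hβ hα), ← div_eq_inv_mul,
    le_div_iff₀ (zero_lt_one.trans_le hi')]
  calc convDen β (eta β f l j) * i
      ≤ convDen β (eta β f l j) * (i : ℝ) ^ 2 := by gcongr; exact le_self_pow₀ hi' two_ne_zero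
    _ ≤ 2 * convDen β (eta β f l j) * (i : ℝ) ^ 2 := by
        rw [mul_assoc 2]
        exact le_mul_of_one_le_left (by positivity) one_le_two
    _ ≤ convDen α (i + 1) := hα.2.2.le

theorem irrational_of_mem_setUj {j : ℕ} (hα : α ∈ setUj β f l j) : Irrational α :=
  have ⟨_, _, hV⟩ := Set.mem_iUnion₂.mp hα
  hV.1

theorem frequently_mem_setUj (hα : α ∈ setU β f l) :
    ∃ᶠ j in atTop, 1 ≤ j ∧ α ∈ setUj β f l j := by
  refine frequently_atTop.mpr fun M => ?_
  obtain ⟨j, hj, hαj⟩ := Set.mem_iUnion₂.mp (Set.mem_iInter₂.mp hα (max M 1) (le_max_right _ _))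
  exact ⟨j, (le_max_left _ _).trans hj, (le_max_right _ _).trans hj, hαj⟩

theorem exists_isResonant (hβ : Irrational β) (hnonneg : ∀ x, 0 ≤ f x) (hint : ∫ x, f x = 1)
    (hl : IsDominantSequence f l) {k : ℕ → ℕ} (hk : StrictMono k)
    (hkU : ∀ n, 1 ≤ k n ∧ α ∈ setUj β f l (k n)) :
    ∃ Q, IsResonant α f (fun n => convDen β (eta β f l (k n))) (fun n => l (k n)) Q := by
  choose i hi_pos hiV using fun n => Set.mem_iUnion₂.mp (hkU n).2
  have hcoeff : ∀ n, coeff f (l (k n)) ≠ 0 := fun n => hl.coeff_ne_zero _ (hkU n).1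
  have hcoeff_le : ∀ n, ‖coeff f (l (k n))‖ ≤ 1 := fun n =>
    (norm_coeff_le_integral hnonneg _).trans hint.le
  have hamplitude : Tendsto (fun n => convDen β (eta β f l (k n)) * ‖coeff f (l (k n))‖) atTop
      atTop :=
    tendsto_atTop_mono (fun n => natCast_le_convDen_eta_mul_norm_coeff hβ (hcoeff n)
      (hcoeff_le n)) (tendsto_natCast_atTop_atTop.comp hk.tendsto_atTop)
  have hfreq : StrictMono fun n => l (k n) := fun _ _ hab =>
    hl.strictMonoOn (hkU _).1 (hkU _).1 (hk hab)
  have hindex : Tendsto i atTop atTop := tendsto_atTop.mpr fun N =>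
    ((tendsto_natCast_atTop_atTop.comp hfreq.tendsto_atTop).eventually_gt_atTop
      (convDen α N)).mono fun n hn => ((convDen_monotone α).reflect_lt
        (hn.trans_eq (hiV n).2.1.symm)).le
  exact ⟨fun n => convDen α (i n + 1),
    { freq_pos := fun n => hl.pos _ (hkU n).1
      Q_pos := fun n => convDen_succ_pos_of_mem_setV hβ (hiV n)
      time_pos := fun n => convDen_eta_pos hβ f l (k n)
      isReducedApprox := fun n => isReducedApprox_of_convDen_eq (hiV n).1 (hiV n).2.1
      coeff_ne_zero := hcoeff
      tendsto_time := tendsto_atTop_mono (fun n => mul_le_of_le_one_right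
        (convDen_eta_pos hβ f l (k n)).le (hcoeff_le n)) hamplitude
      tendsto_tail := hl.tendsto_zero.comp hk.tendsto_atTop
      tendsto_amplitude := hamplitude
      tendsto_ratio := squeeze_zero (fun n => (div_pos (convDen_eta_pos hβ f l (k n))
          (convDen_succ_pos_of_mem_setV hβ (hiV n))).le)
        (fun n => convDen_eta_div_le_inv hβ (hi_pos n) (hiV n))
        (tendsto_inv_atTop_zero.comp (tendsto_natCast_atTop_atTop.comp hindex)) }⟩

end RotationNumbers

/-! ### Fourier coefficients of smooth functions -/

theorem norm_fourierCoeffOn_eq_of_hasDerivAt {a b : ℝ} (hab : a < b) {F F' : ℝ → ℂ} {k : ℤ}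
    (hk : k ≠ 0) (hF : ∀ x ∈ Set.uIcc a b, HasDerivAt F (F' x) x)
    (hF' : IntervalIntegrable F' volume a b) (hends : F a = F b) :
    ‖fourierCoeffOn hab F k‖
      = (b - a) / (2 * Real.pi * |(k : ℝ)|) * ‖fourierCoeffOn hab F' k‖ := by
  rw [fourierCoeffOn_of_hasDerivAt hab hk hF hF', hends, sub_self, mul_zero, zero_sub,
    ← Complex.ofReal_sub]
  simp only [norm_mul, norm_neg, norm_div, norm_one, Complex.norm_I, mul_one, Complex.norm_real,
    Complex.norm_intCast, Real.norm_eq_abs, abs_of_pos Real.pi_pos, Complex.norm_ofNat,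
    abs_of_pos (sub_pos.mpr hab)]
  ring

theorem norm_fourierCoeffOn_eq_iteratedDeriv {a b : ℝ} (hab : a < b) {F : ℝ → ℂ}
    (hper : Function.Periodic F (b - a)) {k : ℤ} (hk : k ≠ 0) {m : ℕ} (hF : ContDiff ℝ m F) :
    ‖fourierCoeffOn hab F k‖ = ((b - a) / (2 * Real.pi * |(k : ℝ)|)) ^ m
      * ‖fourierCoeffOn hab (iteratedDeriv m F) k‖ := by
  induction m with
  | zero => rw [pow_zero, one_mul, iteratedDeriv_zero]
  | succ m ih =>
    have hderiv : ContDiff ℝ 1 (iteratedDeriv m F) := by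
      rw [iteratedDeriv_eq_iterate]
      exact ContDiff.iterate_deriv' 1 m (by rwa [add_comm])
    have hends : iteratedDeriv m F a = iteratedDeriv m F b := by
      have hshift := congrFun (iteratedDeriv_comp_add_const m F (b - a)) a
      rwa [funext hper, add_sub_cancel] at hshift
    rw [ih (hF.of_le (by exact_mod_cast m.le_succ)), norm_fourierCoeffOn_eq_of_hasDerivAt hab hk
      (fun x _ => (hderiv.differentiable one_ne_zero x).hasDerivAt)
      ((hderiv.continuous_deriv le_rfl).intervalIntegrable _ _) hends, iteratedDeriv_succ,
      pow_succ, mul_assoc (_ ^ m)]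

theorem norm_fourierCoeffOn_le_of_norm_le {a b : ℝ} (hab : a < b) {F : ℝ → ℂ} {C : ℝ}
    (hC : ∀ x ∈ Set.Icc a b, ‖F x‖ ≤ C) (k : ℤ) : ‖fourierCoeffOn hab F k‖ ≤ C := by
  have hba := sub_pos.mpr hab
  have hintegral : ‖∫ x in a..b, fourier (-k) (x : AddCircle (b - a)) • F x‖ ≤ C * |b - a| := by
    refine intervalIntegral.norm_integral_le_of_norm_le_const fun x hx => ?_
    rw [Set.uIoc_of_le hab.le] at hx
    rw [norm_smul, fourier_apply, Circle.norm_coe, one_mul]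
    exact hC x (Set.Ioc_subset_Icc_self hx)
  rw [fourierCoeffOn_eq_integral, norm_smul, Real.norm_of_nonneg (by positivity)]
  rw [abs_of_pos hba] at hintegral
  exact (mul_le_mul_of_nonneg_left hintegral (by positivity)).trans_eq (by field_simp)

section Smooth

variable {f : UnitAddCircle → ℝ}

theorem coeff_eq_fourierCoeffOn (f : UnitAddCircle → ℝ) (k : ℤ) :
    coeff f k = fourierCoeffOn zero_lt_one (fun x : ℝ => (f (x : UnitAddCircle) : ℂ)) k := by
  rw [coeff, fourierCoeff_eq_intervalIntegral _ _ 0, fourierCoeffOn_eq_integral]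
  simp

theorem exists_norm_coeff_le {m : ℕ} (hf : ContDiff ℝ m fun x : ℝ => f (x : UnitAddCircle)) :
    ∃ C : ℝ, ∀ k : ℤ, k ≠ 0 → ‖coeff f k‖ ≤ C / |(k : ℝ)| ^ m := by
  set F : ℝ → ℂ := fun x => (f (x : UnitAddCircle) : ℂ) with hF_def
  have hF : ContDiff ℝ m F := Complex.ofRealCLM.contDiff.comp hf
  have hper : Function.Periodic F (1 - 0) := fun x => by simp [hF_def]
  obtain ⟨C, hC⟩ := isCompact_Icc.exists_bound_of_continuousOn (s := Set.Icc (0 : ℝ) 1)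
    (hF.continuous_iteratedDeriv m le_rfl).continuousOn
  refine ⟨C / (2 * Real.pi) ^ m, fun k hk => ?_⟩
  rw [coeff_eq_fourierCoeffOn, norm_fourierCoeffOn_eq_iteratedDeriv zero_lt_one hper hk hF]
  calc _ ≤ ((1 - 0) / (2 * Real.pi * |(k : ℝ)|)) ^ m * C := by
        gcongr
        exact norm_fourierCoeffOn_le_of_norm_le zero_lt_one hC k
    _ = C / (2 * Real.pi) ^ m / |(k : ℝ)| ^ m := by
        rw [sub_zero, div_pow, one_pow, mul_pow]
        ring

theorem summable_norm_coeff_mul_pow {m : ℕ}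
    (hf : ContDiff ℝ (m + 2 : ℕ) fun x : ℝ => f (x : UnitAddCircle)) :
    Summable fun k : ℤ => ‖coeff f k‖ * |(k : ℝ)| ^ m := by
  obtain ⟨C, hC⟩ := exists_norm_coeff_le hf
  refine .of_norm_bounded_eventually
    (((Real.summable_one_div_int_pow (p := 2)).mpr one_lt_two).mul_left C)
    ((Set.finite_singleton (0 : ℤ)).subset fun k hk => ?_)
  by_contra hk0
  have hk_pos : 0 < |(k : ℝ)| := abs_pos.mpr (by exact_mod_cast hk0)
  refine hk ?_
  calc ‖‖coeff f k‖ * |(k : ℝ)| ^ m‖ = ‖coeff f k‖ * |(k : ℝ)| ^ m :=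
        Real.norm_of_nonneg (by positivity)
    _ ≤ C / |(k : ℝ)| ^ (m + 2) * |(k : ℝ)| ^ m := by gcongr; exact hC k hk0
    _ = C * (1 / |(k : ℝ)| ^ 2) := by rw [pow_add]; field_simp
    _ = C * (1 / (k : ℝ) ^ 2) := by rw [sq_abs]

theorem IsRealAnalytic.continuous (hf : IsRealAnalytic f) : Continuous f :=
  QuotientAddGroup.isOpenQuotientMap_mk.isQuotientMap.continuous_iff.mpr
    (continuousOn_univ.mp hf.continuousOn)

theorem IsRealAnalytic.contDiff (hf : IsRealAnalytic f) {n : WithTop ℕ∞} :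
    ContDiff ℝ n fun x : ℝ => f (x : UnitAddCircle) :=
  contDiffOn_univ.mp hf.contDiffOn_of_completeSpace

end Smooth

end SpecialFlowMixing

end

open SpecialFlowMixing in
theorem mainTheorem5_general (β : ℝ) (hβ : Irrational β)
    (f : UnitAddCircle → ℝ) (hf : Continuous f)
    (hf_sum : Summable fun k : ℤ => ‖coeff f k‖ * |(k : ℝ)| ^ 2)
    (hf_pos : ∀ x, 0 < f x) (hf_int : ∫ x : UnitAddCircle, f x = 1)
    (l : ℕ → ℕ) (hl : IsDominantSequence f l)
    (α : ℝ) (hα : α ∈ setU β f l) :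
    (∃ k : ℕ → ℕ, StrictMono k ∧ ∀ n, 1 ≤ k n ∧ α ∈ setUj β f l (k n)) ∧
    ∀ k : ℕ → ℕ, StrictMono k → (∀ n, 1 ≤ k n ∧ α ∈ setUj β f l (k n)) →
      IsMixingAlong (specialFlow α f) (flowMeasure f)
        (fun n => convDen β (eta β f l (k n))) := by
  refine ⟨extraction_of_frequently_atTop (frequently_mem_setUj hα), fun k hk hkU => ?_⟩
  have hα_irr : Irrational α := irrational_of_mem_setUj (hkU 0).2
  have hf_nonneg : ∀ x, 0 ≤ f x := fun x => (hf_pos x).le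
  have hprob := isProbabilityMeasure_flowMeasure hf hf_nonneg hf_int
  obtain ⟨Q, hres⟩ := exists_isResonant hβ hf_nonneg hf_int hl hk hkU
  exact
    { isProbabilityMeasure := hprob
      measurePreserving := measurePreserving_specialFlow α hf hf_pos
      tendsto_atTop := hres.tendsto_time
      tendsto_correlation := fun _ _ => tendsto_correlation_of_isTestFunction hf hf_pos
        fun _ _ => hres.tendsto_correlation hα_irr hf hf_pos hf_int hf_sum }

open SpecialFlowMixing in
theorem mainTheorem5 (β : ℝ) (hβ : Irrational β)
    (f : UnitAddCircle → ℝ) (hf : IsRealAnalytic f) (hf_trig : ¬ IsTrigPolynomial f)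
    (hf_pos : ∀ x, 0 < f x) (hf_int : ∫ x : UnitAddCircle, f x = 1)
    (l : ℕ → ℕ) (hl : IsDominantSequence f l)
    (α : ℝ) (hα : α ∈ setU β f l) :
    (∃ k : ℕ → ℕ, StrictMono k ∧ ∀ n, 1 ≤ k n ∧ α ∈ setUj β f l (k n)) ∧
    ∀ k : ℕ → ℕ, StrictMono k → (∀ n, 1 ≤ k n ∧ α ∈ setUj β f l (k n)) →
      IsMixingAlong (specialFlow α f) (flowMeasure f)
        (fun n => convDen β (eta β f l (k n))) :=
  mainTheorem5_general β hβ f hf.continuous (summable_norm_coeff_mul_pow hf.contDiff) hf_pos hf_int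
    l hl α hα
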